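/- Definitions. Let $m$ goods $v_1,\dots,v_m$ lie, in this order, on a cycle $C$ (for $m\le 2$ read $C$ as the path on $m$ nodes). A bundle is a possibly empty set of goods that induces a connected subgraph of $C$. An $n$-split of $C$ is a sequence of $n$ pairwise disjoint bundles whose union is the set of all goods. A utility function $u$ assigns a non-negative rational to every good and is extended additively to bundles; its maximin share is $$\mathrm{mms}^{(n)}(C,u)=\max_{(P_1,\dots,P_n)}\ \min_{1\le i\le n} u(P_i),$$ where the maximum is over all $n$-splits of $C$. An mms-allocation to agents $1,\dots,n$ with utility functions $w_1,\dots,w_n$ is an $n$-split $(P_1,\dots,P_n)$ of $C$ with $w_i(P_i)\ge \mathrm{mms}^{(n)}(C,w_i)$ for every $i$. An instance with $t$ types is given by the integer $m\ge 0$, utility functions $u_1,\dots,u_t$, each a list of $m$ non-negative rationals written as pairs (numerator, positive denominator), and integers $s_1,\dots,s_t\ge 0$ with $n=s_1+\dots+s_t\ge 1$; there are $s_r$ agents of type $r$, that is, with utility function $u_r$. The size $S$ of the instance is the total length of the binary representations of these integers (so $n$ may be exponential in $S$). An allocation is output as a list that names, for each good, the agent who receives it, by the type $r$ and the index of the agent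 among the $s_r$ agents of type $r$; agents who are not named receive the empty bundle. The machine model is a random access machine on natural numbers with addition, truncated subtraction, halving, direct and indirect addressing, jumps and tests for zero, reading and writing, each at unit cost (polynomially equivalent to multitape Turing machines). Theorem. For every integer $t\ge 1$ there are an algorithm and a polynomial $T$ such that on every instance with $t$ types the algorithm stops after at most $T(S)$ steps; it decides whether there is an mms-allocation of the $m$ goods on the cycle $C$ to the $n$ agents, and if there is one, it outputs one. -/

import Mathlib

/-! ## Maximin share allocations of goods on a graph -/

namespace FairDivision

variable {V : Type} [Fintype V]

/-- A `G`-bundle: a (possibly empty) set of goods that induces a connected subgraph of `G`. -/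
def IsBundle (G : SimpleGraph V) (S : Finset V) : Prop :=
  (G.induce (S : Set V)).Preconnected

/-- A `G`-split indexed by `ι`: pairwise disjoint (possibly empty) `G`-bundles that together
contain all goods. -/
def IsSplit {ι : Type} (G : SimpleGraph V) (P : ι → Finset V) : Prop :=
  (∀ i, IsBundle G (P i)) ∧ (∀ i j, i ≠ j → Disjoint (P i) (P j)) ∧ ∀ v, ∃ i, v ∈ P i

/-- The additive extension of a utility function to sets of goods. -/
def value (u : V → ℝ) (S : Finset V) : ℝ := ∑ v ∈ S, u v

/-- The reals `q ≥ 0` for which there is a `q`-strong split of `G` into `n` bundles. -/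
def strongLevels (G : SimpleGraph V) (u : V → ℝ) (n : ℕ) : Set ℝ :=
  {q | 0 ≤ q ∧ ∃ P : Fin n → Finset V, IsSplit G P ∧ ∀ i, q ≤ value u (P i)}

/-- The maximin share `mms^(n)(G, u)`. The supremum is a maximum whenever `n` is positive, `G` is
connected and `u` is non-negative, see `isGreatest_maximinShare`. -/
noncomputable def maximinShare (G : SimpleGraph V) (u : V → ℝ) (n : ℕ) : ℝ :=
  sSup (strongLevels G u n)

theorem isBundle_empty {W : Type} (G : SimpleGraph W) : IsBundle G ∅ := by
  intro x
  exact absurd x.2 (by simp)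

theorem isBundle_univ {W : Type} [Fintype W] (G : SimpleGraph W) (hG : G.Preconnected) :
    IsBundle G Finset.univ := by
  unfold IsBundle
  rw [Finset.coe_univ]
  exact (SimpleGraph.induceUnivIso G).symm.preconnected_iff.mp hG

theorem isGreatest_maximinShare (G : SimpleGraph V) (hG : G.Preconnected) (u : V → ℝ)
    (hu : ∀ v, 0 ≤ u v) (n : ℕ) (hn : 0 < n) :
    IsGreatest (strongLevels G u n) (maximinShare G u n) := by
  have : Nonempty (Fin n) := ⟨⟨0, hn⟩⟩
  have key : ∃ a, IsGreatest (strongLevels G u n) a := by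
    let T := {P : Fin n → Finset V // IsSplit G P}
    have hT : Nonempty T := by
      refine ⟨⟨fun i => if i = ⟨0, hn⟩ then Finset.univ else ∅, ?_, ?_, ?_⟩⟩
      · intro i
        by_cases h : i = ⟨0, hn⟩
        · simpa only [h, if_true] using isBundle_univ G hG
        · simpa only [h, if_false] using isBundle_empty G
      · intro i j hij
        by_cases h : i = ⟨0, hn⟩
        · have : j ≠ ⟨0, hn⟩ := fun h' => hij (h.trans h'.symm)
          simp [this]
        · simp [h]
      · intro v
        exact ⟨⟨0, hn⟩, by simp⟩
    let f : T → ℝ := fun P =>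
      Finset.univ.inf' Finset.univ_nonempty (fun i => value u (P.1 i))
    have : Finite T := inferInstanceAs (Finite {P : Fin n → Finset V // IsSplit G P})
    obtain ⟨P, hP⟩ := Finite.exists_max f
    refine ⟨f P, ⟨?_, P.1, P.2, ?_⟩, ?_⟩
    · exact Finset.le_inf' _ _ fun i _ => Finset.sum_nonneg fun v _ => hu v
    · exact fun i => Finset.inf'_le _ (Finset.mem_univ i)
    · rintro q ⟨-, Q, hQ, hq⟩
      exact (Finset.le_inf' _ _ fun i _ => hq i).trans (hP ⟨Q, hQ⟩)
  obtain ⟨a, ha⟩ := key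
  rw [maximinShare, ha.csSup_eq]
  exact ha

/-- `P` is an mms-allocation on `G` to the agents `i : ι` with the utility functions `u i`. -/
def IsMMSAllocation {ι : Type} [Fintype ι] (G : SimpleGraph V) (u : ι → V → ℝ)
    (P : ι → Finset V) : Prop :=
  IsSplit G P ∧ ∀ i, maximinShare G (u i) (Fintype.card ι) ≤ value (u i) (P i)

/-- The bundles that result when each good `v` is given to the agent `f v`. -/
def bundlesOf {ι : Type} [DecidableEq ι] (f : V → ι) : ι → Finset V :=
  fun i => Finset.univ.filter fun v => f v = i

end FairDivision

/-! ## Instances: goods on a cycle, agents of `t` types -/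

/-- An instance with `m` goods that lie on a cycle in the order `0, 1, …, m - 1`, with `t`
utility functions whose values are non-negative rationals `num r j / den r j`, and with `count r`
agents of each type `r`. There is at least one agent. -/
structure CycleInstance (t : ℕ) where
  m : ℕ
  num : Fin t → Fin m → ℕ
  den : Fin t → Fin m → ℕ
  den_pos : ∀ r j, 0 < den r j
  count : Fin t → ℕ
  agents_pos : 0 < ∑ r, count r

namespace CycleInstance

variable {t : ℕ} (I : CycleInstance t)

/-- The agents; `⟨r, k⟩` is the `k`-th agent of type `r`. -/
abbrev Agent : Type := Σ r : Fin t, Fin (I.count r)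

/-- The utility function of an agent, which depends only on the type of the agent. -/
noncomputable def utility (i : I.Agent) (j : Fin I.m) : ℝ :=
  (I.num i.1 j : ℝ) / (I.den i.1 j : ℝ)

/-- `P` is an mms-allocation of the goods on the cycle to the agents of the instance. -/
def IsMMSAllocation (P : I.Agent → Finset (Fin I.m)) : Prop :=
  FairDivision.IsMMSAllocation (SimpleGraph.cycleGraph I.m) I.utility P

/-- The instance as a sequence of integers: `m`, then for each type the values of the goods as
pairs (numerator, denominator), then the numbers of agents of each type. -/
def encode : List ℕ :=
  I.m ::
    ((List.ofFn fun r => (List.ofFn fun j => [I.num r j, I.den r j]).flatten).flatten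
      ++ List.ofFn I.count)

/-- The total length of the binary representations of the integers in the instance, where the
representation of `0` has length `1`. -/
def size : ℕ := (I.encode.map fun x => max 1 (Nat.size x)).sum

/-- The output that presents an allocation: `1`, then for each good the type `r` and the
index `k` of the agent `⟨r, k⟩` who receives it. -/
def encodeAllocation (f : Fin I.m → I.Agent) : List ℕ :=
  1 :: (List.ofFn fun j => [((f j).1 : ℕ), ((f j).2 : ℕ)]).flatten

/-- The correct outputs: an encoded mms-allocation if there is an mms-allocation, and the
answer `0` if there is none. -/
def IsCorrectOutput (out : List ℕ) : Prop :=
  ((∃ P, I.IsMMSAllocation P) ∧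
      ∃ f : Fin I.m → I.Agent,
        I.IsMMSAllocation (FairDivision.bundlesOf f) ∧ out = I.encodeAllocation f) ∨
    ((¬ ∃ P, I.IsMMSAllocation P) ∧ out = [0])

end CycleInstance

/-! ## Random access machines

The registers `0, 1, 2, …` hold natural numbers. Every instruction costs one step; since the only
arithmetic is addition, truncated subtraction and halving, running times are polynomially related
to those of multitape Turing machines on binary input. -/

namespace RAM

/-- The instructions. `d`, `a`, `b` are numbers of registers, `c` is a constant and `l` is the
position of an instruction in the program. -/
inductive Instr : Type where
  /-- `R[d] := c` -/
  | const (d c : ℕ)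
  /-- `R[d] := R[a] + R[b]` -/
  | add (d a b : ℕ)
  /-- `R[d] := max (R[a] - R[b]) 0` -/
  | sub (d a b : ℕ)
  /-- `R[d] := ⌊R[a] / 2⌋` -/
  | half (d a : ℕ)
  /-- `R[d] := R[R[a]]` -/
  | load (d a : ℕ)
  /-- `R[R[d]] := R[a]` -/
  | store (d a : ℕ)
  /-- continue at instruction `l` -/
  | jump (l : ℕ)
  /-- continue at instruction `l` if `R[a] = 0` -/
  | jzero (a l : ℕ)
  /-- move the next integer of the input to `R[d]`; at the end of the input `R[d] := 0` -/
  | read (d : ℕ)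
  /-- append `R[a]` to the output -/
  | write (a : ℕ)
  | halt

/-- A program is a finite list of instructions, numbered from `0`. -/
abbrev Program : Type := List Instr

structure Config : Type where
  pc : ℕ
  reg : ℕ → ℕ
  input : List ℕ
  output : List ℕ

/-- Assign a value to register `d` and go to the next instruction. -/
def Config.assign (c : Config) (d x : ℕ) : Config :=
  { c with pc := c.pc + 1, reg := Function.update c.reg d x }

/-- The effect of one instruction; `none` means that the machine stops. -/
def Instr.exec (c : Config) : Instr → Option Config
  | .const d x => some (c.assign d x)
  | .add d a b => some (c.assign d (c.reg a + c.reg b))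
  | .sub d a b => some (c.assign d (c.reg a - c.reg b))
  | .half d a => some (c.assign d (c.reg a / 2))
  | .load d a => some (c.assign d (c.reg (c.reg a)))
  | .store d a => some (c.assign (c.reg d) (c.reg a))
  | .jump l => some { c with pc := l }
  | .jzero a l => some { c with pc := if c.reg a = 0 then l else c.pc + 1 }
  | .read d => some { c.assign d (c.input.headD 0) with input := c.input.tail }
  | .write a => some { c with pc := c.pc + 1, output := c.output ++ [c.reg a] }
  | .halt => none

/-- One step of the program. The machine also stops when it leaves the program. -/
def step (p : Program) (c : Config) : Option Config :=
  p[c.pc]?.bind (Instr.exec c)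

/-- `Runs p k c c'`: the program goes from `c` to `c'` in exactly `k` steps. -/
inductive Runs (p : Program) : ℕ → Config → Config → Prop
  | refl (c : Config) : Runs p 0 c c
  | step {k : ℕ} {c c' c'' : Config} :
      step p c = some c' → Runs p k c' c'' → Runs p (k + 1) c c''

/-- The initial configuration: all registers are `0`. -/
def init (x : List ℕ) : Config := ⟨0, fun _ => 0, x, []⟩

/-- On input `x` the program stops after at most `T` steps, and then its output is `y`. -/
def OutputsWithin (p : Program) (x : List ℕ) (T : ℕ) (y : List ℕ) : Prop :=
  ∃ k ≤ T, ∃ c, Runs p k (init x) c ∧ step p c = none ∧ c.output = y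

end RAM

/-! ## Code fragments and their running times -/

namespace RAM

variable {p : Program}

/-! If there are more agents than goods, some bundle of every split is empty, so all maximin shares
are `0` and one agent may take everything (`isMMSAllocation_const`). This disposes of exponentially
many agents. Otherwise `n ≤ m`, and the number of agents is polynomial in the length of the input.

A split of the cycle can be cut at some good `s` so that every bundle is an interval in the order of
distances from `s` (`exists_cut`). For each of the `m` cuts a dynamic program looks for a sequence
of `n` intervals. Its state is a position and the multiset of agents still to be served, and this
multiset is written as a number in base `n + 1` with one digit per type. There are at most `(n + 1)
^ t` such numbers, polynomially many for fixed `t`. Since only `n` intervals are used, the number of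
intervals of each type is a proper digit, and uniqueness of digits (`digits_unique`) shows that a
used-up budget means that every agent got exactly one interval.

The shares are never computed. An optimal split attains the share at its worst bundle, which is an
arc; so an arc reaches the share if and only if no arc of greater value is a level, that is, a lower
bound for all bundles of some split (`maximinShare_le_iff`). Levels are tested by the same dynamic
program with a single type (`isLevel_iff`). Multiplication by all denominators of a type makes the
values natural numbers.

On the machine side, `PolyTime` is a class of functions that is closed under composition, pairing,
case distinction and loops of `B ^ e` rounds, where `B` is the bit length of the input.
Multiplication, small division, search and bit tables held in a single number are built from these,
`fun_prop` certifies the whole algorithm, and `exists_program` wraps it with code for reading and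
writing. Loops are truncated at `B ^ e` rounds; hence the time bound holds unconditionally, and size
estimates are needed only for correctness. -/

theorem Runs.trans {k l : ℕ} {a b c : Config} (h : Runs p k a b) (h' : Runs p l b c) :
    Runs p (k + l) a c := by
  induction h with
  | refl => simpa using h'
  | @step k a a' b hs _ ih =>
    rw [show k + 1 + l = k + l + 1 by omega]
    exact Runs.step hs (ih h')

/-- The program goes from `c` to `c'` in at most `T` steps. -/
def Reach (p : Program) (T : ℕ) (c c' : Config) : Prop := ∃ k ≤ T, Runs p k c c'

theorem Reach.refl (T : ℕ) (c : Config) : Reach p T c c := ⟨0, Nat.zero_le _, .refl c⟩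

theorem Reach.trans {k l : ℕ} {a b c : Config} (h : Reach p k a b) (h' : Reach p l b c) :
    Reach p (k + l) a c := by
  obtain ⟨i, hi, hr⟩ := h
  obtain ⟨j, hj, hr'⟩ := h'
  exact ⟨i + j, by omega, hr.trans hr'⟩

theorem Reach.mono {k l : ℕ} {a b : Config} (h : Reach p k a b) (hl : k ≤ l) : Reach p l a b := by
  obtain ⟨i, hi, hr⟩ := h
  exact ⟨i, hi.trans hl, hr⟩

theorem Reach.of_instr {c c' : Config} {q : Instr} (h : p[c.pc]? = some q)
    (h' : q.exec c = some c') : Reach p 1 c c' :=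
  ⟨1, le_rfl, .step (by simp [RAM.step, h, h']) (.refl c')⟩

/-- The fragment `q` occurs in the program `p` at position `pos`. -/
def CodeAt (p : Program) (pos : ℕ) (q : List Instr) : Prop :=
  ∀ i (h : i < q.length), p[pos + i]? = some q[i]

theorem codeAt_nil (pos : ℕ) : CodeAt p pos [] := by
  intro i h
  simp at h

theorem codeAt_cons {pos : ℕ} {a : Instr} {q : List Instr} :
    CodeAt p pos (a :: q) ↔ p[pos]? = some a ∧ CodeAt p (pos + 1) q := by
  constructor
  · intro h
    refine ⟨h 0 (by simp), fun i hi => ?_⟩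
    have := h (i + 1) (by simpa using hi)
    rw [show pos + 1 + i = pos + (i + 1) by omega]
    simpa using this
  · rintro ⟨h0, h⟩ i hi
    cases i with
    | zero => simpa using h0
    | succ i =>
      have := h i (by simpa using hi)
      rw [show pos + (i + 1) = pos + 1 + i by omega]
      simpa using this

theorem codeAt_append {pos : ℕ} {q q' : List Instr} :
    CodeAt p pos (q ++ q') ↔ CodeAt p pos q ∧ CodeAt p (pos + q.length) q' := by
  induction q generalizing pos with
  | nil => simp [codeAt_nil]
  | cons a q ih =>
    rw [List.cons_append, codeAt_cons, codeAt_cons, ih, and_assoc, List.length_cons,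
      show pos + 1 + q.length = pos + (q.length + 1) by omega]

theorem codeAt_self (p : Program) : CodeAt p 0 p := by
  intro i h
  simp [h]

section Instructions

variable {pc : ℕ} {R : ℕ → ℕ} {inp out : List ℕ} {d a b l : ℕ}

theorem reach_const (h : p[pc]? = some (.const d a)) :
    Reach p 1 ⟨pc, R, inp, out⟩ ⟨pc + 1, Function.update R d a, inp, out⟩ :=
  .of_instr h rfl

theorem reach_add (h : p[pc]? = some (.add d a b)) :
    Reach p 1 ⟨pc, R, inp, out⟩ ⟨pc + 1, Function.update R d (R a + R b), inp, out⟩ :=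
  .of_instr h rfl

theorem reach_sub (h : p[pc]? = some (.sub d a b)) :
    Reach p 1 ⟨pc, R, inp, out⟩ ⟨pc + 1, Function.update R d (R a - R b), inp, out⟩ :=
  .of_instr h rfl

theorem reach_half (h : p[pc]? = some (.half d a)) :
    Reach p 1 ⟨pc, R, inp, out⟩ ⟨pc + 1, Function.update R d (R a / 2), inp, out⟩ :=
  .of_instr h rfl

theorem reach_load (h : p[pc]? = some (.load d a)) :
    Reach p 1 ⟨pc, R, inp, out⟩ ⟨pc + 1, Function.update R d (R (R a)), inp, out⟩ :=
  .of_instr h rfl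

theorem reach_store (h : p[pc]? = some (.store d a)) :
    Reach p 1 ⟨pc, R, inp, out⟩ ⟨pc + 1, Function.update R (R d) (R a), inp, out⟩ :=
  .of_instr h rfl

theorem reach_jump (h : p[pc]? = some (.jump l)) :
    Reach p 1 ⟨pc, R, inp, out⟩ ⟨l, R, inp, out⟩ :=
  .of_instr h rfl

theorem reach_jzero_of_eq (h : p[pc]? = some (.jzero a l)) (h0 : R a = 0) :
    Reach p 1 ⟨pc, R, inp, out⟩ ⟨l, R, inp, out⟩ :=
  .of_instr h (by simp [Instr.exec, h0])

theorem reach_jzero_of_ne (h : p[pc]? = some (.jzero a l)) (h0 : R a ≠ 0) :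
    Reach p 1 ⟨pc, R, inp, out⟩ ⟨pc + 1, R, inp, out⟩ :=
  .of_instr h (by simp [Instr.exec, h0])

theorem reach_read (h : p[pc]? = some (.read d)) :
    Reach p 1 ⟨pc, R, inp, out⟩ ⟨pc + 1, Function.update R d (inp.headD 0), inp.tail, out⟩ :=
  .of_instr h rfl

theorem reach_write (h : p[pc]? = some (.write a)) :
    Reach p 1 ⟨pc, R, inp, out⟩ ⟨pc + 1, R, inp, out ++ [R a]⟩ :=
  .of_instr h rfl

end Instructions

/-- Copy the registers `src, …, src + w - 1` to `dst, …, dst + w - 1`. -/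
def copyCode (src dst : ℕ) : ℕ → List Instr
  | 0 => []
  | w + 1 => copyCode src dst w ++ [.const (dst + w) 0, .add (dst + w) (dst + w) (src + w)]

theorem length_copyCode (src dst w : ℕ) : (copyCode src dst w).length = 2 * w := by
  induction w with
  | zero => rfl
  | succ w ih => simp [copyCode, ih]; omega

/-- Copying goes upwards, so the two blocks may overlap if the target lies below the source. -/
theorem reach_copyCode {src dst w pos : ℕ} (R : ℕ → ℕ) (inp out : List ℕ)
    (h : dst < src ∨ src + w ≤ dst) (hc : CodeAt p pos (copyCode src dst w)) :
    ∃ R', Reach p (2 * w) ⟨pos, R, inp, out⟩ ⟨pos + 2 * w, R', inp, out⟩ ∧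
      (∀ i < w, R' (dst + i) = R (src + i)) ∧
      ∀ i, i < dst ∨ dst + w ≤ i → R' i = R i := by
  induction w with
  | zero => exact ⟨R, .refl _ _, by simp, by simp⟩
  | succ w ih =>
    rw [copyCode, codeAt_append, length_copyCode, codeAt_cons, codeAt_cons] at hc
    obtain ⟨h0, h1, h2, -⟩ := hc
    obtain ⟨R', hr, hR, hR'⟩ := ih (by omega) h0
    have e1 := reach_const (R := R') (inp := inp) (out := out) h1
    have e2 := reach_add (R := Function.update R' (dst + w) 0) (inp := inp) (out := out) h2
    refine ⟨_, ((hr.trans e1).trans e2).mono (by omega), ?_, ?_⟩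
    · intro i hi
      by_cases hiw : i = w
      · subst hiw
        have : src + i ≠ dst + i := by omega
        simp only [Function.update_self, Function.update_of_ne this, zero_add]
        exact hR' _ (by omega)
      · have : dst + i ≠ dst + w := by omega
        rw [Function.update_of_ne this, Function.update_of_ne this]
        exact hR i (by omega)
    · intro i hi
      have : i ≠ dst + w := by omega
      rw [Function.update_of_ne this, Function.update_of_ne this]
      exact hR' i (by omega)

/-! ## Functions that are computed in polynomial time relative to a context -/

/-- What stays in the memory throughout a computation: a number `B`, in which running times are
measured, and the input. -/
structure Ctx where
  B : ℕ
  inp : ℕ → ℕ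

/-- The representation of the elements of `α` by `dim` registers. The context that is part of
an element has to be the context in the memory. -/
class Enc (α : Type) where
  dim : ℕ
  enc : α → ℕ → ℕ
  ok : α → Ctx → Prop

open Enc

instance : Enc ℕ := ⟨1, fun a _ => a, fun _ _ => True⟩

/-- The context takes no registers of its own: there is one copy in the memory, and `ok` ties every
occurrence to it. So it can be an argument at no cost. -/
instance : Enc Ctx := ⟨0, fun _ _ => 0, fun x y => x = y⟩

instance {α β : Type} [Enc α] [Enc β] : Enc (α × β) :=
  ⟨dim α + dim β, fun a i => if i < dim α then enc a.1 i else enc a.2 (i - dim α),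
    fun a x => ok a.1 x ∧ ok a.2 x⟩

section Enc

variable {α β : Type} [Enc α] [Enc β]

@[simp] theorem dim_nat : dim ℕ = 1 := rfl
@[simp] theorem dim_ctx : dim Ctx = 0 := rfl
@[simp] theorem dim_prod : dim (α × β) = dim α + dim β := rfl
@[simp] theorem enc_nat (a i : ℕ) : enc a i = a := rfl
@[simp] theorem ok_nat (a : ℕ) (x : Ctx) : ok a x := trivial
@[simp] theorem ok_ctx (a x : Ctx) : ok a x ↔ a = x := Iff.rfl
@[simp] theorem ok_prod (a : α × β) (x : Ctx) : ok a x ↔ ok a.1 x ∧ ok a.2 x := Iff.rfl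

/-- The registers from `b` on represent `a`. -/
def Holds (R : ℕ → ℕ) (b : ℕ) (a : α) : Prop := ∀ i < dim α, R (b + i) = enc a i

theorem Holds.congr {R R' : ℕ → ℕ} {b : ℕ} {a : α} (h : Holds R b a)
    (hR : ∀ i, b ≤ i → i < b + dim α → R' i = R i) : Holds R' b a := by
  intro i hi
  rw [hR _ (by omega) (by omega), h i hi]

theorem holds_prod {R : ℕ → ℕ} {b : ℕ} {a : α × β} :
    Holds R b a ↔ Holds R b a.1 ∧ Holds R (b + dim α) a.2 := by
  constructor
  · intro h
    refine ⟨fun i hi => ?_, fun i hi => ?_⟩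
    · rw [h i (by simp; omega)]
      exact if_pos hi
    · rw [add_assoc, h (dim α + i) (by simp; omega)]
      refine (if_neg (by omega)).trans ?_
      rw [Nat.add_sub_cancel_left]
  · rintro ⟨h1, h2⟩ i hi
    by_cases h : i < dim α
    · rw [h1 i h]
      exact (if_pos h).symm
    · have := h2 (i - dim α) (by simp at hi; omega)
      rw [show b + dim α + (i - dim α) = b + i by omega] at this
      rw [this]
      exact (if_neg h).symm

theorem holds_nat {R : ℕ → ℕ} {b a : ℕ} : Holds R b a ↔ R b = a := by
  constructor
  · intro h
    simpa using h 0 (by simp)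
  · intro h i hi
    obtain rfl : i = 0 := by simpa using hi
    simpa using h

theorem holds_ctx {R : ℕ → ℕ} {b : ℕ} {a : Ctx} : Holds R b a := by
  intro i hi
  simp at hi

end Enc

/-- The context `x` is in the memory: `B` in register `0`, the input in the registers from `K`
on. -/
def InMemory (x : Ctx) (K : ℕ) (R : ℕ → ℕ) : Prop := R 0 = x.B ∧ ∀ i, R (K + i) = x.inp i

theorem InMemory.congr {x : Ctx} {K t : ℕ} {R R' : ℕ → ℕ} (h : InMemory x K R) (ht : 0 < t)
    (hR : ∀ i, i < t ∨ K ≤ i → R' i = R i) : InMemory x K R' :=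
  ⟨by rw [hR 0 (.inl ht), h.1], fun i => by rw [hR _ (.inr (by omega)), h.2 i]⟩

/-- The fragments `code K b t pos` of length `len` compute `f`: from the argument in the registers
from `b` on the value in the registers from `t` on. They use only the registers
`t, …, t + h - 1`. -/
structure Implements {α β : Type} [Enc α] [Enc β] (f : α → β) (len h : ℕ) (T : Polynomial ℕ)
    (code : ℕ → ℕ → ℕ → ℕ → List Instr) : Prop where
  length_eq : ∀ K b t pos, (code K b t pos).length = len
  dim_le : dim β ≤ h
  correct : ∀ {p : Program} {K b t pos : ℕ} {x : Ctx} {a : α} {R : ℕ → ℕ} {inp out : List ℕ},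
    CodeAt p pos (code K b t pos) → 0 < b → b + dim α ≤ t → t + h ≤ K → ok a x →
    InMemory x K R → Holds R b a →
    ∃ R', Reach p (T.eval x.B) ⟨pos, R, inp, out⟩ ⟨pos + len, R', inp, out⟩ ∧
      ok (f a) x ∧ Holds R' t (f a) ∧ ∀ i, i < t ∨ K ≤ i → R' i = R i

/-- `f` is computed by a fragment of a program in polynomial time. -/
@[fun_prop]
def PolyTime {α β : Type} [Enc α] [Enc β] (f : α → β) : Prop :=
  ∃ len h T code, Implements f len h T code

/-! ### Closure properties of polynomial-time functions -/

namespace PolyTime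

variable {α β γ : Type} [Enc α] [Enc β] [Enc γ]

/-- For maps that select a contiguous block of the argument, at offset `o`: the identity and the
projections. -/
theorem copy {f : α → β} (o : ℕ) (ho : o + dim β ≤ dim α)
    (h : ∀ a x, ok a x → ok (f a) x) (hf : ∀ R b a, Holds R b a → Holds R (b + o) (f a)) :
    PolyTime f := by
  refine ⟨2 * dim β, dim β, Polynomial.C (2 * dim β), fun K b t pos => copyCode (b + o) t (dim β),
    fun K b t pos => length_copyCode _ _ _, le_rfl, ?_⟩
  intro p K b t pos x a R inp out hc hb hbt htK ha hx hR
  obtain ⟨R', hr, h1, h2⟩ := reach_copyCode R inp out (by omega) hc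
  refine ⟨R', by simpa using hr, h a x ha, ?_, ?_⟩
  · intro i hi
    rw [h1 i hi]
    exact hf R b a hR i hi
  · intro i hi
    exact h2 i (by omega)

@[fun_prop]
theorem id : PolyTime (fun a : α => a) :=
  copy 0 (by simp) (fun _ _ h => h) (fun _ _ _ h => h)

@[fun_prop]
theorem fst : PolyTime (fun a : α × β => a.1) :=
  copy 0 (by simp) (fun _ _ h => h.1) (fun _ _ _ h => (holds_prod.1 h).1)

@[fun_prop]
theorem snd : PolyTime (fun a : α × β => a.2) :=
  copy (dim α) (by simp) (fun _ _ h => h.2) (fun _ _ _ h => (holds_prod.1 h).2)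

@[fun_prop]
theorem comp {g : β → γ} {f : α → β} (hg : PolyTime g) (hf : PolyTime f) :
    PolyTime (fun a => g (f a)) := by
  obtain ⟨l₁, h₁, T₁, c₁, H₁⟩ := hf
  obtain ⟨l₂, h₂, T₂, c₂, H₂⟩ := hg
  have hd₁ := H₁.dim_le
  have hd₂ := H₂.dim_le
  -- The intermediate value sits at `t`, the final one is formed above it and copied down. The
  -- additional `1` keeps the target of the copy strictly below its source even if `dim β = 0`.
  refine ⟨l₁ + l₂ + 2 * dim γ, h₁ + h₂ + dim β + 1, T₁ + T₂ + Polynomial.C (2 * dim γ),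
    fun K b t pos => (c₁ K b t pos ++ c₂ K t (t + dim β + 1) (pos + l₁)) ++
      copyCode (t + dim β + 1) t (dim γ), ?_, by omega, ?_⟩
  · intro K b t pos
    simp [H₁.length_eq, H₂.length_eq, length_copyCode, add_assoc]
  intro p K b t pos x a R inp out hc hb hbt htK ha hx hR
  rw [codeAt_append, codeAt_append, List.length_append, H₁.length_eq, H₂.length_eq] at hc
  obtain ⟨⟨hc₁, hc₂⟩, hc₃⟩ := hc
  obtain ⟨R₁, hr₁, ho₁, hv₁, hk₁⟩ := H₁.correct (inp := inp) (out := out) hc₁ hb hbt (by omega)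
    ha hx hR
  obtain ⟨R₂, hr₂, ho₂, hv₂, hk₂⟩ := H₂.correct (inp := inp) (out := out) hc₂ (by omega)
    (by omega) (by omega) ho₁ (hx.congr (by omega) hk₁) hv₁
  rw [← add_assoc] at hc₃
  obtain ⟨R₃, hr₃, hv₃, hk₃⟩ := reach_copyCode R₂ inp out (by omega) hc₃
  refine ⟨R₃, ?_, ho₂, ?_, ?_⟩
  · have := (hr₁.trans hr₂).trans hr₃
    simpa [add_assoc] using this
  · intro i hi
    rw [hv₃ i hi, hv₂ i hi]
  · intro i hi
    rw [hk₃ i (by omega), hk₂ i (by omega), hk₁ i (by omega)]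

@[fun_prop]
theorem prodMk {f : α → β} {g : α → γ} (hf : PolyTime f) (hg : PolyTime g) :
    PolyTime (fun a => (f a, g a)) := by
  obtain ⟨l₁, h₁, T₁, c₁, H₁⟩ := hf
  obtain ⟨l₂, h₂, T₂, c₂, H₂⟩ := hg
  have hd₁ := H₁.dim_le
  have hd₂ := H₂.dim_le
  refine ⟨l₁ + l₂, h₁ + h₂ + dim β, T₁ + T₂,
    fun K b t pos => c₁ K b t pos ++ c₂ K b (t + dim β) (pos + l₁), ?_, by simp; omega, ?_⟩
  · intro K b t pos
    simp [H₁.length_eq, H₂.length_eq]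
  intro p K b t pos x a R inp out hc hb hbt htK ha hx hR
  rw [codeAt_append, H₁.length_eq] at hc
  obtain ⟨hc₁, hc₂⟩ := hc
  obtain ⟨R₁, hr₁, ho₁, hv₁, hk₁⟩ := H₁.correct (inp := inp) (out := out) hc₁ hb hbt (by omega)
    ha hx hR
  obtain ⟨R₂, hr₂, ho₂, hv₂, hk₂⟩ := H₂.correct (inp := inp) (out := out) hc₂ hb
    (by omega) (by omega) ha (hx.congr (by omega) hk₁)
    (hR.congr fun i _ _ => hk₁ i (.inl (by omega)))
  refine ⟨R₂, ?_, ⟨ho₁, ho₂⟩, ?_, ?_⟩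
  · have := hr₁.trans hr₂
    simpa [add_assoc] using this
  · exact holds_prod.2 ⟨hv₁.congr fun i _ _ => hk₂ i (.inl (by omega)), hv₂⟩
  · intro i hi
    rw [hk₂ i (by omega), hk₁ i (by omega)]

@[fun_prop]
theorem const (n : ℕ) : PolyTime (fun _ : α => n) := by
  refine ⟨1, 1, 1, fun K b t pos => [.const t n], fun _ _ _ _ => rfl, le_rfl, ?_⟩
  intro p K b t pos x a R inp out hc hb hbt htK ha hx hR
  refine ⟨_, by simpa using reach_const (codeAt_cons.1 hc).1, trivial,
    holds_nat.2 (Function.update_self ..),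
    fun i hi => Function.update_of_ne (show i ≠ t by omega) ..⟩

theorem add' : PolyTime (fun a : ℕ × ℕ => a.1 + a.2) := by
  refine ⟨1, 1, 1, fun K b t pos => [.add t b (b + 1)], fun _ _ _ _ => rfl, le_rfl, ?_⟩
  intro p K b t pos x a R inp out hc hb hbt htK ha hx hR
  obtain ⟨h1, h2⟩ := holds_prod.1 hR
  refine ⟨_, by simpa using reach_add (codeAt_cons.1 hc).1, trivial,
    holds_nat.2 ?_, fun i hi => Function.update_of_ne (show i ≠ t by omega) ..⟩
  rw [Function.update_self, holds_nat.1 h1, ← holds_nat.1 h2]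
  rfl

theorem sub' : PolyTime (fun a : ℕ × ℕ => a.1 - a.2) := by
  refine ⟨1, 1, 1, fun K b t pos => [.sub t b (b + 1)], fun _ _ _ _ => rfl, le_rfl, ?_⟩
  intro p K b t pos x a R inp out hc hb hbt htK ha hx hR
  obtain ⟨h1, h2⟩ := holds_prod.1 hR
  refine ⟨_, by simpa using reach_sub (codeAt_cons.1 hc).1, trivial,
    holds_nat.2 ?_, fun i hi => Function.update_of_ne (show i ≠ t by omega) ..⟩
  rw [Function.update_self, holds_nat.1 h1, ← holds_nat.1 h2]
  rfl

theorem half' : PolyTime (fun a : ℕ => a / 2) := by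
  refine ⟨1, 1, 1, fun K b t pos => [.half t b], fun _ _ _ _ => rfl, le_rfl, ?_⟩
  intro p K b t pos x a R inp out hc hb hbt htK ha hx hR
  refine ⟨_, by simpa using reach_half (codeAt_cons.1 hc).1, trivial,
    holds_nat.2 ?_, fun i hi => Function.update_of_ne (show i ≠ t by omega) ..⟩
  rw [Function.update_self, holds_nat.1 hR]

theorem inp' : PolyTime (fun a : Ctx × ℕ => a.1.inp a.2) := by
  refine ⟨3, 1, 3, fun K b t pos => [.const t K, .add t t b, .load t t], fun _ _ _ _ => rfl,
    le_rfl, ?_⟩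
  intro p K b t pos x a R inp out hc hb hbt htK ha hx hR
  have h2 := holds_nat.1 (holds_prod.1 hR).2
  obtain ⟨y, a⟩ := a
  obtain ⟨rfl, -⟩ := ha
  simp only [codeAt_cons] at hc
  obtain ⟨c1, c2, c3, -⟩ := hc
  have r1 := reach_const (R := R) (inp := inp) (out := out) c1
  have r2 := reach_add (R := Function.update R t K) (inp := inp) (out := out) c2
  have r3 := reach_load (R := Function.update (Function.update R t K) t
    (Function.update R t K t + Function.update R t K b)) (inp := inp) (out := out) c3
  have htb : b ≠ t := by simp at hbt; omega
  have hKt : K + a ≠ t := by omega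
  refine ⟨_, by simpa using (r1.trans r2).trans r3, trivial, holds_nat.2 ?_, ?_⟩
  · simp only [Function.update_self, Function.update_of_ne htb]
    simp only [show R b = a from h2, Function.update_of_ne hKt, hx.2]
  · intro i hi
    have : i ≠ t := by omega
    simp only [Function.update_of_ne this]

@[fun_prop]
theorem add {f g : α → ℕ} (hf : PolyTime f) (hg : PolyTime g) :
    PolyTime (fun a => f a + g a) :=
  add'.comp (hf.prodMk hg)

@[fun_prop]
theorem sub {f g : α → ℕ} (hf : PolyTime f) (hg : PolyTime g) :
    PolyTime (fun a => f a - g a) :=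
  sub'.comp (hf.prodMk hg)

@[fun_prop]
theorem half {f : α → ℕ} (hf : PolyTime f) : PolyTime (fun a => f a / 2) :=
  half'.comp hf

@[fun_prop]
theorem inp {f : α → Ctx} {g : α → ℕ} (hf : PolyTime f) (hg : PolyTime g) :
    PolyTime (fun a => (f a).inp (g a)) :=
  inp'.comp (hf.prodMk hg)

/-- The only branching; comparisons are reduced to it by truncated subtraction. -/
theorem ite_eq_zero {c : α → ℕ} {f g : α → β} (hc : PolyTime c) (hf : PolyTime f)
    (hg : PolyTime g) : PolyTime (fun a => if c a = 0 then f a else g a) := by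
  obtain ⟨l₁, h₁, T₁, c₁, H₁⟩ := hf
  obtain ⟨l₂, h₂, T₂, c₂, H₂⟩ := hg
  obtain ⟨l₀, h₀, T₀, c₀, H₀⟩ := hc
  have hd₁ := H₁.dim_le
  have hd₂ := H₂.dim_le
  refine ⟨l₀ + (l₂ + l₁ + 2), h₀ + h₁ + h₂, T₀ + T₁ + T₂ + 2,
    fun K b t pos => c₀ K b t pos ++ .jzero t (pos + l₀ + 1 + l₂ + 1) ::
      (c₂ K b t (pos + l₀ + 1) ++ .jump (pos + l₀ + 1 + l₂ + 1 + l₁) ::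
        c₁ K b t (pos + l₀ + 1 + l₂ + 1)), ?_, by omega, ?_⟩
  · intro K b t pos
    simp [H₀.length_eq, H₁.length_eq, H₂.length_eq]
    omega
  intro p K b t pos x a R inp out hc hb hbt htK ha hx hR
  rw [codeAt_append, codeAt_cons, codeAt_append, codeAt_cons, H₀.length_eq, H₂.length_eq] at hc
  obtain ⟨hc₀, hz, hc₂, hj, hc₁⟩ := hc
  obtain ⟨R₀, hr₀, ho₀, hv₀, hk₀⟩ := H₀.correct (inp := inp) (out := out) hc₀ hb hbt (by omega)
    ha hx hR
  have hv₀ := holds_nat.1 hv₀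
  have hx₀ := hx.congr (by omega) hk₀
  have hR₀ := hR.congr fun i _ _ => hk₀ i (.inl (by omega))
  by_cases h : c a = 0
  · have hz := reach_jzero_of_eq (inp := inp) (out := out) hz (hv₀.trans h)
    obtain ⟨R₁, hr₁, ho₁, hv₁, hk₁⟩ := H₁.correct (inp := inp) (out := out) hc₁ hb hbt (by omega)
      ha hx₀ hR₀
    simp only [if_pos h]
    refine ⟨R₁, ?_, ho₁, hv₁, fun i hi => by rw [hk₁ i (by omega), hk₀ i (by omega)]⟩
    rw [show pos + (l₀ + (l₂ + l₁ + 2)) = pos + l₀ + 1 + l₂ + 1 + l₁ by omega]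
    refine ((hr₀.trans hz).trans hr₁).mono ?_
    simp only [Polynomial.eval_add, Polynomial.eval_ofNat]
    omega
  · have hz := reach_jzero_of_ne (R := R₀) (inp := inp) (out := out) hz (by rwa [hv₀])
    obtain ⟨R₁, hr₁, ho₁, hv₁, hk₁⟩ := H₂.correct (inp := inp) (out := out) hc₂ hb hbt (by omega)
      ha hx₀ hR₀
    simp only [if_neg h]
    refine ⟨R₁, ?_, ho₁, hv₁, fun i hi => by rw [hk₁ i (by omega), hk₀ i (by omega)]⟩
    have hj := reach_jump (R := R₁) (inp := inp) (out := out) hj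
    rw [show pos + (l₀ + (l₂ + l₁ + 2)) = pos + l₀ + 1 + l₂ + 1 + l₁ by omega]
    refine (((hr₀.trans hz).trans hr₁).trans hj).mono ?_
    simp only [Polynomial.eval_add, Polynomial.eval_ofNat]
    omega

/-- The only loop. The number of rounds comes from register `0` and not from the argument, so the
running time is polynomial whatever the argument is. The counter lies directly above the current
value, and the scratch space of `F` above the counter. -/
theorem iterate' {F : α → α} (hF : PolyTime F) :
    PolyTime (fun a : Ctx × α => F^[a.1.B] a.2) := by
  obtain ⟨l, h, T, c, H⟩ := hF
  have hd := H.dim_le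
  let body (K t pos : ℕ) : List Instr :=
    .jzero (t + dim α) (pos + l + 2 * dim α + 4) :: (c K t (t + dim α + 1) (pos + 1) ++
      (copyCode (t + dim α + 1) t (dim α) ++ [.const (t + dim α + 1) 1,
        .sub (t + dim α) (t + dim α) (t + dim α + 1), .jump pos]))
  have key : ∀ {p : Program} {K t pos : ℕ} {x : Ctx} {inp out : List ℕ},
      CodeAt p pos (body K t pos) → 0 < t → t + dim α + 1 + h + 1 ≤ K →
      ∀ (n : ℕ) (a : α) (R : ℕ → ℕ), ok a x → InMemory x K R → Holds R t a → R (t + dim α) = n →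
      ∃ R', Reach p (n * (T.eval x.B + 2 * dim α + 4) + 1) ⟨pos, R, inp, out⟩
          ⟨pos + l + 2 * dim α + 4, R', inp, out⟩ ∧
        ok (F^[n] a) x ∧ Holds R' t (F^[n] a) ∧ ∀ i, i < t ∨ K ≤ i → R' i = R i := by
    intro p K t pos x inp out hc ht htK n
    simp only [body, codeAt_cons, codeAt_append, H.length_eq, length_copyCode] at hc
    obtain ⟨hz, hc₁, hc₂, h1, h2, h3, -⟩ := hc
    induction n with
    | zero =>
      intro a R ha hx hR hn
      exact ⟨R, by simpa using reach_jzero_of_eq hz hn, ha, hR, fun _ _ => rfl⟩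
    | succ n ih =>
      intro a R ha hx hR hn
      have hz := reach_jzero_of_ne (R := R) (inp := inp) (out := out) hz (by rw [hn]; omega)
      obtain ⟨R₁, hr₁, ho₁, hv₁, hk₁⟩ := H.correct (inp := inp) (out := out) hc₁ ht (by omega)
        (by omega) ha hx hR
      obtain ⟨R₂, hr₂, hv₂, hk₂⟩ := reach_copyCode R₁ inp out (by omega) hc₂
      have hn₂ : R₂ (t + dim α) = n + 1 := by
        rw [hk₂ _ (by omega), hk₁ _ (by omega), hn]
      have r1 := reach_const (R := R₂) (inp := inp) (out := out) h1
      have r2 := reach_sub (R := Function.update R₂ (t + dim α + 1) 1) (inp := inp) (out := out) h2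
      generalize hR₃ : Function.update (Function.update R₂ (t + dim α + 1) 1) (t + dim α)
        (Function.update R₂ (t + dim α + 1) 1 (t + dim α) -
          Function.update R₂ (t + dim α + 1) 1 (t + dim α + 1)) = R₃ at r2
      have r3 := reach_jump (R := R₃) (inp := inp) (out := out) h3
      have hk₃ : ∀ i, i < t + dim α ∨ K ≤ i → R₃ i = R₂ i := by
        intro i hi
        rw [← hR₃, Function.update_of_ne (by omega), Function.update_of_ne (by omega)]
      have hn₃ : R₃ (t + dim α) = n := by
        rw [← hR₃, Function.update_self, Function.update_self, Function.update_of_ne (by omega),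
          hn₂, Nat.add_sub_cancel]
      have hk : ∀ i, i < t ∨ K ≤ i → R₃ i = R i := fun i hi => by
        rw [hk₃ i (by omega), hk₂ i (by omega), hk₁ i (by omega)]
      obtain ⟨R₄, hr₄, ho₄, hv₄, hk₄⟩ := ih (F a) R₃ ho₁ (hx.congr ht hk) (fun i hi => by
        rw [hk₃ _ (by omega), hv₂ i hi, hv₁ i hi]) hn₃
      refine ⟨R₄, ?_, ho₄, hv₄, fun i hi => by rw [hk₄ i hi, hk i hi]⟩
      refine ((((((hz.trans hr₁).trans hr₂).trans r1).trans r2).trans r3).trans hr₄).mono ?_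
      rw [Nat.add_mul, one_mul]
      omega
  -- Adding register `0` to the cleared counter loads `x.B`.
  refine ⟨2 * dim α + 2 + (l + 2 * dim α + 4), dim α + 1 + h + 1,
    Polynomial.C (2 * dim α + 3) + Polynomial.X * (T + Polynomial.C (2 * dim α + 4)),
    fun K b t pos => copyCode b t (dim α) ++ .const (t + dim α) 0 ::
      .add (t + dim α) (t + dim α) 0 :: body K t (pos + (2 * dim α + 2)), ?_, by omega, ?_⟩
  · intro K b t pos
    simp [body, H.length_eq, length_copyCode]
    omega
  intro p K b t pos x a R inp out hc hb hbt htK ha hx hR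
  obtain ⟨y, a⟩ := a
  obtain ⟨rfl, ha⟩ := ha
  have hR := (holds_prod.1 hR).2
  simp only [dim_ctx, add_zero, dim_prod, zero_add] at hR hbt ha
  simp only [codeAt_append, codeAt_cons, length_copyCode] at hc
  obtain ⟨hc₁, h1, h2, hc₂⟩ := hc
  obtain ⟨R₁, hr₁, hv₁, hk₁⟩ := reach_copyCode R inp out (by omega) hc₁
  have r1 := reach_const (R := R₁) (inp := inp) (out := out) h1
  have r2 := reach_add (R := Function.update R₁ (t + dim α) 0) (inp := inp) (out := out) h2
  generalize hR₃ : Function.update (Function.update R₁ (t + dim α) 0) (t + dim α)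
        (Function.update R₁ (t + dim α) 0 (t + dim α) +
          Function.update R₁ (t + dim α) 0 0) = R₃ at r2
  have hk₃ : ∀ i, i < t + dim α ∨ K ≤ i → R₃ i = R₁ i := by
    intro i hi
    rw [← hR₃, Function.update_of_ne (by omega), Function.update_of_ne (by omega)]
  have hk : ∀ i, i < t ∨ K ≤ i → R₃ i = R i := fun i hi => by
    rw [hk₃ i (by omega), hk₁ i (by omega)]
  have hn₃ : R₃ (t + dim α) = y.B := by
    rw [← hR₃, Function.update_self, Function.update_self, Function.update_of_ne (by omega),
      hk₁ _ (by omega), hx.1, zero_add]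
  obtain ⟨R₄, hr₄, ho₄, hv₄, hk₄⟩ := key (inp := inp) (out := out) hc₂ (by omega) (by omega)
    y.B a R₃ ha (hx.congr (by omega) hk) (fun i hi => by
      rw [hk₃ _ (by omega), hv₁ i hi, hR i hi]) hn₃
  refine ⟨R₄, ?_, ho₄, hv₄, fun i hi => by rw [hk₄ i hi, hk i hi]⟩
  have := ((hr₁.trans r1).trans r2).trans hr₄
  rw [show pos + 2 * dim α + 1 + 1 + l + 2 * dim α + 4 =
    pos + (2 * dim α + 2 + (l + 2 * dim α + 4)) by omega] at this
  refine this.mono ?_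
  simp only [Polynomial.eval_add, Polynomial.eval_mul, Polynomial.eval_C, Polynomial.eval_X]
  rw [← add_assoc (T.eval y.B)]
  omega

end PolyTime
end RAM

/-! ## Programs from functions -/

namespace RAM

theorem size_eq_size_half_add_one {x : ℕ} (hx : x ≠ 0) : Nat.size x = Nat.size (x / 2) + 1 := by
  have h := Nat.size_bit (b := x.bodd) (n := x.div2) (by rwa [Nat.bit_bodd_div2])
  rw [Nat.bit_bodd_div2, Nat.div2_val] at h
  exact h

/-- The number of integers in `xs` plus the total length of their binary representations. -/
def bitLength (xs : List ℕ) : ℕ := (xs.map fun x => 1 + Nat.size x).sum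

theorem bitLength_cons (x : ℕ) (xs : List ℕ) :
    bitLength (x :: xs) = 1 + Nat.size x + bitLength xs := rfl

/-- The context for the input `xs`. -/
def Ctx.ofList (xs : List ℕ) : Ctx := ⟨bitLength xs, fun i => xs.getD i 0⟩

/-- Read `1 + R[1]` integers; the first is already in register `3`. Store them from the address
in register `2` on and add the length to register `0`. -/
def readCode (pos : ℕ) : List Instr :=
  [.store 2 3, .add 2 2 4, .add 0 0 4, .jzero 3 (pos + 7), .half 3 3, .add 0 0 4, .jump (pos + 3),
    .jzero 1 (pos + 11), .sub 1 1 4, .read 3, .jump pos]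

/-- Halving `x` down to `0` takes one round of four steps per bit, and each round adds the `1` in
register `4` to register `0`. -/
theorem reach_bits {p : Program} {pos : ℕ} (hc : CodeAt p pos (readCode pos)) (inp out : List ℕ)
    (x : ℕ) (R : ℕ → ℕ) (h3 : R 3 = x) (h4 : R 4 = 1) :
    ∃ R', Reach p (4 * Nat.size x + 1) ⟨pos + 3, R, inp, out⟩ ⟨pos + 7, R', inp, out⟩ ∧
      R' 0 = R 0 + Nat.size x ∧ ∀ i, i ≠ 0 → i ≠ 3 → R' i = R i := by
  induction x using Nat.strong_induction_on generalizing R with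
  | _ x ih =>
    have hc' := hc
    simp only [readCode, codeAt_cons] at hc'
    obtain ⟨-, -, -, c3, c4, c5, c6, -⟩ := hc'
    by_cases hx : x = 0
    · subst hx
      refine ⟨R, ?_, by simp, fun _ _ _ => rfl⟩
      simpa [Nat.size_zero] using reach_jzero_of_eq (inp := inp) (out := out) c3 h3
    · have r3 := reach_jzero_of_ne (R := R) (inp := inp) (out := out) c3 (by rwa [h3])
      have r4 := reach_half (R := R) (inp := inp) (out := out) c4
      generalize hR₁ : Function.update R 3 (R 3 / 2) = R₁ at r4
      have r5 := reach_add (R := R₁) (inp := inp) (out := out) c5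
      generalize hR₂ : Function.update R₁ 0 (R₁ 0 + R₁ 4) = R₂ at r5
      have r6 := reach_jump (R := R₂) (inp := inp) (out := out) c6
      obtain ⟨R', hr, h0, hk⟩ := ih (x / 2) (by omega) R₂
        (by simp [← hR₂, ← hR₁, h3]) (by simp [← hR₂, ← hR₁, h4])
      rw [size_eq_size_half_add_one hx]
      refine ⟨R', ((((r3.trans r4).trans r5).trans r6).trans hr).mono (by omega), ?_, ?_⟩
      · rw [h0]
        simp [← hR₂, ← hR₁, h4]
        omega
      · intro i h0 h3
        rw [hk i h0 h3]
        simp [← hR₂, ← hR₁, h0, h3]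

/-- An integer `x` costs `3` steps for storing, `4 * Nat.size x + 1` for counting its bits and at
most `4` for moving on, hence at most `8 * (1 + Nat.size x)`. The number `k` counts the integers
that are already stored, which must survive. -/
theorem reach_readCode {p : Program} {pos K : ℕ} (hK : 4 < K) (hc : CodeAt p pos (readCode pos))
    (out : List ℕ) (xs : List ℕ) (x k : ℕ) (R : ℕ → ℕ) (h1 : R 1 = xs.length) (h2 : R 2 = K + k)
    (h3 : R 3 = x) (h4 : R 4 = 1) :
    ∃ R', Reach p (8 * bitLength (x :: xs)) ⟨pos, R, xs, out⟩ ⟨pos + 11, R', [], out⟩ ∧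
      R' 0 = R 0 + bitLength (x :: xs) ∧ (∀ i < k, R' (K + i) = R (K + i)) ∧
      ∀ i, R' (K + k + i) = if h : i < (x :: xs).length then (x :: xs)[i] else R (K + k + i) := by
  induction xs generalizing x k R with
  | nil =>
    have hc' := hc
    simp only [readCode, codeAt_cons] at hc'
    obtain ⟨c0, c1, c2, -, -, -, -, c7, -⟩ := hc'
    have r0 := reach_store (R := R) (inp := []) (out := out) c0
    generalize hR₁ : Function.update R (R 2) (R 3) = R₁ at r0
    have r1 := reach_add (R := R₁) (inp := []) (out := out) c1
    generalize hR₂ : Function.update R₁ 2 (R₁ 2 + R₁ 4) = R₂ at r1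
    have r2 := reach_add (R := R₂) (inp := []) (out := out) c2
    generalize hR₃ : Function.update R₂ 0 (R₂ 0 + R₂ 4) = R₃ at r2
    have e (i : ℕ) (hi : i < K) : R₁ i = R i := by
      rw [← hR₁, Function.update_of_ne (by omega)]
    have e' (i : ℕ) (hi : 2 < i) : R₃ i = R₁ i := by
      rw [← hR₃, Function.update_of_ne (by omega), ← hR₂, Function.update_of_ne (by omega)]
    obtain ⟨R₄, hr, h0, hk⟩ := reach_bits hc [] out x R₃
      (by rw [e' _ (by omega), e _ (by omega), h3]) (by rw [e' _ (by omega), e _ (by omega), h4])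
    have h1' : R₄ 1 = 0 := by
      rw [hk 1 (by omega) (by omega), ← hR₃, Function.update_of_ne (by omega), ← hR₂,
        Function.update_of_ne (by omega), e _ (by omega), h1]
      rfl
    have r7 := reach_jzero_of_eq (inp := []) (out := out) c7 h1'
    refine ⟨R₄, ((((r0.trans r1).trans r2).trans hr).trans r7).mono ?_, ?_, ?_, ?_⟩
    · simp only [bitLength, List.map_cons, List.map_nil, List.sum_cons, List.sum_nil]
      omega
    · rw [h0, ← hR₃, Function.update_self, ← hR₂, Function.update_of_ne (by omega),
        Function.update_of_ne (by omega), e _ (by omega), e _ (by omega), h4]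
      simp only [bitLength, List.map_cons, List.map_nil, List.sum_cons, List.sum_nil]
      omega
    · intro i hi
      rw [hk _ (by omega) (by omega), e' _ (by omega), ← hR₁, Function.update_of_ne (by omega)]
    · intro i
      rw [hk _ (by omega) (by omega), e' _ (by omega), ← hR₁]
      rcases i with _ | i
      · simp [h2, h3]
      · rw [Function.update_of_ne (by omega)]
        simp
  | cons y ys ih =>
    have hc' := hc
    simp only [readCode, codeAt_cons] at hc'
    obtain ⟨c0, c1, c2, -, -, -, -, c7, c8, c9, c10, -⟩ := hc'
    have r0 := reach_store (R := R) (inp := y :: ys) (out := out) c0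
    generalize hR₁ : Function.update R (R 2) (R 3) = R₁ at r0
    have r1 := reach_add (R := R₁) (inp := y :: ys) (out := out) c1
    generalize hR₂ : Function.update R₁ 2 (R₁ 2 + R₁ 4) = R₂ at r1
    have r2 := reach_add (R := R₂) (inp := y :: ys) (out := out) c2
    generalize hR₃ : Function.update R₂ 0 (R₂ 0 + R₂ 4) = R₃ at r2
    have e (i : ℕ) (hi : i < K) : R₁ i = R i := by
      rw [← hR₁, Function.update_of_ne (by omega)]
    have e' (i : ℕ) (hi : 2 < i) : R₃ i = R₁ i := by
      rw [← hR₃, Function.update_of_ne (by omega), ← hR₂, Function.update_of_ne (by omega)]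
    obtain ⟨R₄, hr, h0, hk⟩ := reach_bits hc (y :: ys) out x R₃
      (by rw [e' _ (by omega), e _ (by omega), h3]) (by rw [e' _ (by omega), e _ (by omega), h4])
    have h1' : R₄ 1 = ys.length + 1 := by
      rw [hk 1 (by omega) (by omega), ← hR₃, Function.update_of_ne (by omega), ← hR₂,
        Function.update_of_ne (by omega), e _ (by omega), h1]
      rfl
    have h2' : R₄ 2 = K + (k + 1) := by
      rw [hk 2 (by omega) (by omega), ← hR₃, Function.update_of_ne (by omega), ← hR₂,
        Function.update_self, e _ (by omega), h2, e _ (by omega), h4]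
      rfl
    have h4' : R₄ 4 = 1 := by
      rw [hk 4 (by omega) (by omega), e' _ (by omega), e _ (by omega), h4]
    have r7 := reach_jzero_of_ne (R := R₄) (inp := y :: ys) (out := out) c7 (by omega)
    have r8 := reach_sub (R := R₄) (inp := y :: ys) (out := out) c8
    generalize hR₅ : Function.update R₄ 1 (R₄ 1 - R₄ 4) = R₅ at r8
    have r9 := reach_read (R := R₅) (inp := y :: ys) (out := out) c9
    simp only [List.headD_cons, List.tail_cons] at r9
    generalize hR₆ : Function.update R₅ 3 y = R₆ at r9
    have r10 := reach_jump (R := R₆) (inp := ys) (out := out) c10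
    have e'' (i : ℕ) (h1 : i ≠ 1) (h3 : i ≠ 3) : R₆ i = R₄ i := by
      rw [← hR₆, Function.update_of_ne h3, ← hR₅, Function.update_of_ne h1]
    obtain ⟨R', hr', h0', hk', hs⟩ := ih y (k + 1) R₆
      (by rw [← hR₆, Function.update_of_ne (by omega), ← hR₅, Function.update_self]; omega)
      (by rw [e'' _ (by omega) (by omega), h2'])
      (by rw [← hR₆, Function.update_self]) (by rw [e'' _ (by omega) (by omega), h4'])
    refine ⟨R', ((((((((r0.trans r1).trans r2).trans hr).trans r7).trans r8).trans r9).trans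
      r10).trans hr').mono ?_, ?_, ?_, ?_⟩
    · rw [bitLength_cons x]
      omega
    · rw [h0', e'' _ (by omega) (by omega), h0, ← hR₃, Function.update_self, ← hR₂,
        Function.update_of_ne (by omega), Function.update_of_ne (by omega), e _ (by omega),
        e _ (by omega), h4]
      rw [bitLength_cons x]
      omega
    · intro i hi
      rw [hk' i (by omega), e'' _ (by omega) (by omega), hk _ (by omega) (by omega),
        e' _ (by omega), ← hR₁, Function.update_of_ne (by omega)]
    · intro i
      rcases i with _ | i
      · rw [add_zero, hk' k (by omega), e'' _ (by omega) (by omega), hk _ (by omega) (by omega),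
          e' _ (by omega), ← hR₁, h2, Function.update_self, h3]
        simp
      · have := hs i
        rw [show K + (k + 1) + i = K + k + (i + 1) by omega] at this
        rw [this, e'' _ (by omega) (by omega), hk _ (by omega) (by omega), e' _ (by omega), ← hR₁,
          Function.update_of_ne (by omega)]
        simp

/-- Write `E 0, …, E (L - 1)`, where `L` is in register `1`. -/
def writeCode (code : ℕ → ℕ → ℕ → ℕ → List Instr) (l K pos : ℕ) : List Instr :=
  .sub 3 1 2 :: .jzero 3 (pos + l + 6) :: (code K 2 3 (pos + 2) ++
    [.write 3, .const 3 1, .add 2 2 3, .jump pos, .halt])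

open Enc in
theorem reach_writeCode {p : Program} {K pos l h : ℕ} {T : Polynomial ℕ}
    {code : ℕ → ℕ → ℕ → ℕ → List Instr} {E : Ctx × ℕ → ℕ} (H : Implements E l h T code)
    (hc : CodeAt p pos (writeCode code l K pos)) (hK : 3 + h ≤ K) {x : Ctx} {inp : List ℕ}
    (n i : ℕ) (R : ℕ → ℕ) (out : List ℕ) (hx : InMemory x K R) (h1 : R 1 = i + n) (h2 : R 2 = i) :
    ∃ R', Reach p (n * (T.eval x.B + 6) + 2) ⟨pos, R, inp, out⟩
      ⟨pos + l + 6, R', inp, out ++ (List.range' i n).map fun j => E (x, j)⟩ := by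
  have hh : 1 ≤ h := H.dim_le
  simp only [writeCode, codeAt_cons, codeAt_append, H.length_eq] at hc
  obtain ⟨c0, c1, c2, c3, c4, c5, c6, -, -⟩ := hc
  induction n generalizing i R out with
  | zero =>
    have r0 := reach_sub (R := R) (inp := inp) (out := out) c0
    have r1 := reach_jzero_of_eq (R := Function.update R 3 (R 1 - R 2)) (inp := inp) (out := out) c1
      (by simp [h1, h2])
    exact ⟨_, by simpa using r0.trans r1⟩
  | succ n ih =>
    have r0 := reach_sub (R := R) (inp := inp) (out := out) c0
    generalize hR₁ : Function.update R 3 (R 1 - R 2) = R₁ at r0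
    have e (j : ℕ) (hj : j ≠ 3) : R₁ j = R j := by rw [← hR₁, Function.update_of_ne hj]
    have r1 := reach_jzero_of_ne (R := R₁) (inp := inp) (out := out) c1
      (by rw [← hR₁, Function.update_self]; omega)
    obtain ⟨R₂, r2, -, hv, hk⟩ := H.correct (x := x) (a := (x, i)) (R := R₁) (inp := inp)
      (out := out) c2 (by omega) (by simp) hK (by simp)
      ⟨by rw [e 0 (by omega), hx.1], fun j => by rw [e _ (by omega), hx.2]⟩
      (holds_prod.2 ⟨holds_ctx, holds_nat.2 (by simp [e 2, h2])⟩)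
    have hv := holds_nat.1 hv
    have r3 := reach_write (R := R₂) (inp := inp) (out := out) c3
    have r4 := reach_const (R := R₂) (inp := inp) (out := out ++ [R₂ 3]) c4
    generalize hR₃ : Function.update R₂ 3 1 = R₃ at r4
    have r5 := reach_add (R := R₃) (inp := inp) (out := out ++ [R₂ 3]) c5
    generalize hR₄ : Function.update R₃ 2 (R₃ 2 + R₃ 3) = R₄ at r5
    have r6 := reach_jump (R := R₄) (inp := inp) (out := out ++ [R₂ 3]) c6
    have e' (j : ℕ) (hj : j < 2 ∨ K ≤ j) : R₄ j = R j := by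
      rw [← hR₄, Function.update_of_ne (by omega), ← hR₃, Function.update_of_ne (by omega),
        hk _ (by omega), e _ (by omega)]
    obtain ⟨R', hr⟩ := ih (i + 1) R₄ (out ++ [R₂ 3])
      ⟨by rw [e' 0 (by omega), hx.1], fun j => by rw [e' _ (by omega), hx.2]⟩
      (by rw [e' _ (by omega), h1]; omega)
      (by rw [← hR₄, Function.update_self, ← hR₃, Function.update_of_ne (by omega),
        Function.update_self, hk _ (by omega), e _ (by omega), h2])
    refine ⟨R', ?_⟩
    have := (((((((r0.trans r1).trans r2).trans r3).trans r4).trans r5).trans r6).trans hr)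
    rw [hv, List.append_assoc, List.singleton_append] at this
    rw [List.range'_succ, List.map_cons]
    refine this.mono ?_
    rw [Nat.add_mul]
    omega

theorem reach_replicate_add {p : Program} {inp out : List ℕ} (n : ℕ) {pos : ℕ} (R : ℕ → ℕ)
    (hc : CodeAt p pos (List.replicate n (.add 1 1 3))) :
    Reach p n ⟨pos, R, inp, out⟩ ⟨pos + n, Function.update R 1 (R 1 + n * R 3), inp, out⟩ := by
  induction n generalizing pos R with
  | zero => simpa using Reach.refl (p := p) 0 _
  | succ n ih =>
    rw [List.replicate_succ, codeAt_cons] at hc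
    have r := reach_add (R := R) (inp := inp) (out := out) hc.1
    have := r.trans (ih _ hc.2)
    rw [Function.update_idem, Function.update_self, Function.update_of_ne (by omega),
      show pos + 1 + n = pos + (n + 1) by omega, show R 1 + R 3 + n * R 3 = R 1 + (n + 1) * R 3 by
        ring] at this
    exact this.mono (by omega)

/-- If the length `L` and the entries `E` of an output can be computed in polynomial time, then
there is a program that prints the output. The first integer `m` of the input determines that
there are `a * m + b` further integers. -/
theorem exists_program (a b : ℕ) {L : Ctx → ℕ} {E : Ctx × ℕ → ℕ} (hL : PolyTime L)
    (hE : PolyTime E) : ∃ (p : Program) (T : Polynomial ℕ), ∀ (m : ℕ) (xs : List ℕ),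
      xs.length = a * m + b → L (Ctx.ofList (m :: xs)) ≤ bitLength (m :: xs) →
      OutputsWithin p (m :: xs) (T.eval (bitLength (m :: xs)))
        ((List.range (L (Ctx.ofList (m :: xs)))).map fun i => E (Ctx.ofList (m :: xs), i)) := by
  obtain ⟨l₁, h₁, T₁, c₁, H₁⟩ := hL
  obtain ⟨l₂, h₂, T₂, c₂, H₂⟩ := hE
  have hh₁ : 1 ≤ h₁ := H₁.dim_le
  have hh₂ : 1 ≤ h₂ := H₂.dim_le
  -- The reading phase uses the registers `0` to `4`, and the fragments for `L` and `E` start at the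
  -- registers `1` and `3`; all of them stay below `K`, where the input is stored.
  let K := 5 + h₁ + h₂
  -- Since `a` is fixed, `a * m + b` is obtained by `a` additions of `m`.
  let pre : Program := [.const 4 1, .const 2 K, .read 3, .const 1 b] ++
    List.replicate a (.add 1 1 3)
  have hpre : pre.length = 4 + a := by simp [pre]; omega
  let p : Program := pre ++ (readCode (4 + a) ++ (c₁ K 1 1 (4 + a + 11) ++
    (.const 2 0 :: writeCode c₂ l₂ K (4 + a + 11 + l₁ + 1))))
  refine ⟨p, Polynomial.C (4 + a) + Polynomial.C 8 * Polynomial.X + T₁ + 1 +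
    (Polynomial.X * (T₂ + 6) + 2), ?_⟩
  intro m xs hlen hLB
  generalize hx : Ctx.ofList (m :: xs) = x at hLB
  have hxB : bitLength (m :: xs) = x.B := by rw [← hx]; rfl
  have hc := codeAt_self p
  simp only [p, codeAt_append (q := pre), hpre, zero_add] at hc
  obtain ⟨hc₀, hc⟩ := hc
  rw [codeAt_append, show (readCode (4 + a)).length = 11 from rfl, codeAt_append, H₁.length_eq,
    codeAt_cons] at hc
  obtain ⟨hc₁, hc₂, hc₃, hc₄⟩ := hc
  simp only [pre, codeAt_append, codeAt_cons] at hc₀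
  obtain ⟨⟨k0, k1, k2, k3, -⟩, k4⟩ := hc₀
  have r0 := reach_const (R := fun _ => 0) (inp := m :: xs) (out := []) k0
  generalize hR₁ : Function.update (fun _ => 0) 4 1 = R₁ at r0
  have r1 := reach_const (R := R₁) (inp := m :: xs) (out := []) k1
  generalize hR₂ : Function.update R₁ 2 K = R₂ at r1
  have r2 := reach_read (R := R₂) (inp := m :: xs) (out := []) k2
  simp only [List.headD_cons, List.tail_cons] at r2
  generalize hR₃ : Function.update R₂ 3 m = R₃ at r2
  have r3 := reach_const (R := R₃) (inp := xs) (out := []) k3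
  generalize hR₄ : Function.update R₃ 1 b = R₄ at r3
  have r4 := reach_replicate_add (inp := xs) (out := []) a R₄ k4
  generalize hR₅ : Function.update R₄ 1 (R₄ 1 + a * R₄ 3) = R₅ at r4
  have hz (i : ℕ) (hi : i = 0 ∨ 4 < i) : R₅ i = 0 := by
    rw [← hR₅, Function.update_of_ne (by omega), ← hR₄, Function.update_of_ne (by omega), ← hR₃,
      Function.update_of_ne (by omega), ← hR₂, Function.update_of_ne (by omega), ← hR₁,
      Function.update_of_ne (by omega)]
  have e1 : R₅ 1 = xs.length := by simp [← hR₅, ← hR₄, ← hR₃, hlen]; omega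
  have e2 : R₅ 2 = K + 0 := by simp [← hR₅, ← hR₄, ← hR₃, ← hR₂]
  have e3 : R₅ 3 = m := by simp [← hR₅, ← hR₄, ← hR₃]
  have e4 : R₅ 4 = 1 := by simp [← hR₅, ← hR₄, ← hR₃, ← hR₂, ← hR₁]
  obtain ⟨R₆, r5, h0, -, hm⟩ := reach_readCode (K := K) (by omega) hc₁ [] xs m 0 R₅ e1 e2 e3 e4
  have hmem : InMemory x K R₆ := by
    refine ⟨by rw [h0, hz _ (.inl rfl), hxB, zero_add], fun i => ?_⟩
    have := hm i
    rw [add_zero, hz _ (.inr (by omega))] at this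
    rw [this, ← hx]
    simp [Ctx.ofList, List.getD_eq_getElem?_getD]
    split_ifs with h
    · rw [List.getElem?_eq_getElem (by simpa using h)]
      rfl
    · rw [List.getElem?_eq_none (by simp; omega)]
      rfl
  obtain ⟨R₇, r6, -, hv, hk⟩ := H₁.correct (a := x) (inp := []) (out := []) hc₂ (by omega)
    (by simp) (by omega) (by simp) hmem holds_ctx
  have hv := holds_nat.1 hv
  have r7 := reach_const (R := R₇) (inp := []) (out := []) hc₃
  generalize hR₈ : Function.update R₇ 2 0 = R₈ at r7
  obtain ⟨R', r8⟩ := reach_writeCode H₂ hc₄ (by omega) (x := x) (inp := []) (L x) 0 R₈ []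
    ((hmem.congr (by omega) hk).congr (t := 1) (by omega)
      (fun i hi => by rw [← hR₈, Function.update_of_ne (by omega)]))
    (by simp [← hR₈, hv]) (by simp [← hR₈])
  have r := ((((((r0.trans r1).trans r2).trans r3).trans r4).trans r5).trans
    r6).trans (r7.trans r8)
  rw [hxB] at r
  obtain ⟨k, hk, hr⟩ := r
  refine ⟨k, hk.trans ?_, _, hr, ?_, ?_⟩
  · rw [hxB] at hLB
    rw [hxB]
    simp only [Polynomial.eval_add, Polynomial.eval_mul, Polynomial.eval_C, Polynomial.eval_X,
      Polynomial.eval_ofNat, Polynomial.eval_one]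
    -- The bound on `L` limits the number of rounds of the output loop by `x.B`.
    have := Nat.mul_le_mul_right (T₂.eval x.B + 6) hLB
    omega
  · simp only [writeCode, codeAt_cons, codeAt_append, H₂.length_eq] at hc₄
    obtain ⟨-, -, -, -, -, -, -, hh, -⟩ := hc₄
    have : p[4 + a + 11 + l₁ + 1 + l₂ + 6]? = some .halt := by
      rw [← hh]
      congr 1
      omega
    simp [step, this, Instr.exec]
  · simp [List.range_eq_range']

end RAM

/-! ## Bounded recursion and arithmetic in polynomial time -/

namespace RAM

/-- Recursion with at most `x.B ^ e` steps. -/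
def boundedRec (e : ℕ) (x : Ctx) (n a : ℕ) (f : ℕ → ℕ → ℕ) : ℕ :=
  Nat.rec a f (min n (x.B ^ e))

namespace PolyTime

variable {α β γ : Type} [Enc α] [Enc β] [Enc γ]

/-- Loops are nested: `B` rounds of `F^[B ^ e]` amount to `B ^ (e + 1)` rounds of `F`. The context
is carried along in the state because the inner loop needs it. -/
theorem iterate_pow {F : α → α} (hF : PolyTime F) (e : ℕ) :
    PolyTime (fun a : Ctx × α => F^[a.1.B ^ e] a.2) := by
  induction e with
  | zero => simpa using hF.comp snd
  | succ e ih =>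
    have h := (iterate' (fst.prodMk ih)).comp
      (f := fun a : Ctx × α => (a.1, a)) (fst.prodMk id)
    have key (y : Ctx) (a : α) (k : ℕ) :
        ((fun b : Ctx × α => (b.1, F^[b.1.B ^ e] b.2))^[k] (y, a)) =
          (y, (F^[y.B ^ e])^[k] a) := by
      induction k generalizing a with
      | zero => rfl
      | succ k ih => rw [Function.iterate_succ_apply, ih, Function.iterate_succ_apply]
    have h := snd.comp h
    simp only [key, ← Function.iterate_mul] at h
    simpa only [pow_succ] using h

@[fun_prop]
theorem boundedRec {e : ℕ} {x : α → Ctx} {n a : α → ℕ} {f : α → ℕ → ℕ → ℕ} (hx : PolyTime x)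
    (hn : PolyTime n) (ha : PolyTime a)
    (hf : PolyTime (fun p : α × ℕ × ℕ => f p.1 p.2.1 p.2.2)) :
    PolyTime (fun v => boundedRec e (x v) (n v) (a v) (f v)) := by
  -- The loop always makes `B ^ e` rounds; once the counter has reached `n`, the remaining rounds
  -- change nothing.
  let F (s : (α × ℕ) × ℕ × ℕ) : (α × ℕ) × ℕ × ℕ :=
    if s.1.2 - s.2.1 = 0 then s else (s.1, s.2.1 + 1, f s.1.1 s.2.1 s.2.2)
  have hf' : PolyTime (fun s : (α × ℕ) × ℕ × ℕ => f s.1.1 s.2.1 s.2.2) :=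
    hf.comp (f := fun s : (α × ℕ) × ℕ × ℕ => (s.1.1, s.2.1, s.2.2)) (by fun_prop)
  have hF : PolyTime F := ite_eq_zero (by fun_prop) id (by fun_prop)
  have h := (iterate_pow hF e).comp (f := fun v => (x v, (v, n v), 0, a v)) (by fun_prop)
  have key (v : α) (m a k : ℕ) : F^[k] ((v, m), 0, a) =
      ((v, m), min m k, Nat.rec a (f v) (min m k)) := by
    induction k with
    | zero => simp
    | succ k ih =>
      rw [Function.iterate_succ_apply', ih]
      simp only [F]
      by_cases hk : m ≤ k
      · rw [min_eq_left hk, min_eq_left (by omega), if_pos (by omega)]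
      · rw [min_eq_right (by omega), min_eq_right (by omega), if_neg (by omega)]
  have h := (snd.comp snd).comp h
  simp only [key] at h
  exact h

@[fun_prop]
theorem ite_le {c d : α → ℕ} {f g : α → β} (hc : PolyTime c) (hd : PolyTime d) (hf : PolyTime f)
    (hg : PolyTime g) : PolyTime (fun a => if c a ≤ d a then f a else g a) := by
  simpa only [Nat.sub_eq_zero_iff_le] using ite_eq_zero (hc.sub hd) hf hg

@[fun_prop]
theorem ite_eq {c d : α → ℕ} {f g : α → β} (hc : PolyTime c) (hd : PolyTime d) (hf : PolyTime f)
    (hg : PolyTime g) : PolyTime (fun a => if c a = d a then f a else g a) := by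
  have h := ite_eq_zero ((hc.sub hd).add (hd.sub hc)) hf hg
  have e (a : α) : c a - d a + (d a - c a) = 0 ↔ c a = d a := by omega
  simpa only [e] using h

end PolyTime

variable (e : ℕ) (x : Ctx)

/-- The rule for loop invariants. The hypothesis `hn` says that the truncation has no effect. -/
theorem boundedRec_induction {n a : ℕ} {f : ℕ → ℕ → ℕ} (P : ℕ → ℕ → Prop) (hn : n ≤ x.B ^ e)
    (h0 : P 0 a) (hs : ∀ i v, i < n → P i v → P (i + 1) (f i v)) : P n (boundedRec e x n a f) := by
  rw [boundedRec, min_eq_left hn]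
  have : ∀ k ≤ n, P k (Nat.rec a f k) := by
    intro k hk
    induction k with
    | zero => exact h0
    | succ k ih => exact hs k _ hk (ih (by omega))
  exact this n le_rfl

theorem boundedRec_zero (a : ℕ) (f : ℕ → ℕ → ℕ) : boundedRec e x 0 a f = a := by
  simp [boundedRec]

theorem boundedRec_succ {n : ℕ} (a : ℕ) (f : ℕ → ℕ → ℕ) (hn : n < x.B ^ e) :
    boundedRec e x (n + 1) a f = f n (boundedRec e x n a f) := by
  rw [boundedRec, boundedRec, min_eq_left (by omega), min_eq_left (by omega)]

/-- The sum of `f i` for `i < n`. -/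
def sum (n : ℕ) (f : ℕ → ℕ) : ℕ := boundedRec e x n 0 fun i v => v + f i

@[fun_prop]
theorem PolyTime.sum {α : Type} [Enc α] {e : ℕ} {x : α → Ctx} {n : α → ℕ} {f : α → ℕ → ℕ}
    (hx : PolyTime x) (hn : PolyTime n) (hf : PolyTime (fun p : α × ℕ => f p.1 p.2)) :
    PolyTime (fun v => sum e (x v) (n v) (f v)) := by
  have hf : PolyTime (fun s : α × ℕ × ℕ => f s.1 s.2.1) :=
    hf.comp (f := fun s : α × ℕ × ℕ => (s.1, s.2.1)) (by fun_prop)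
  unfold RAM.sum
  fun_prop

theorem sum_eq {n : ℕ} (f : ℕ → ℕ) (hn : n ≤ x.B ^ e) : sum e x n f = ∑ i ∈ Finset.range n, f i :=
  boundedRec_induction e x (fun k v => v = ∑ i ∈ Finset.range k, f i) hn rfl
    (by rintro i v - rfl; rw [Finset.sum_range_succ])

/-- `b * 2 ^ i` -/
def shift (b i : ℕ) : ℕ := boundedRec e x i b fun _ v => v + v

/-- The bit `i` of `a`. -/
def bit (a i : ℕ) : ℕ :=
  boundedRec e x i a (fun _ v => v / 2) -
    (boundedRec e x i a (fun _ v => v / 2) / 2 + boundedRec e x i a (fun _ v => v / 2) / 2)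

@[fun_prop]
theorem PolyTime.bit {α : Type} [Enc α] {e : ℕ} {x : α → Ctx} {a i : α → ℕ}
    (hx : PolyTime x) (ha : PolyTime a) (hi : PolyTime i) :
    PolyTime (fun v => bit e (x v) (a v) (i v)) := by
  unfold RAM.bit
  fun_prop

@[fun_prop]
theorem PolyTime.shift {α : Type} [Enc α] {e : ℕ} {x : α → Ctx} {a i : α → ℕ}
    (hx : PolyTime x) (ha : PolyTime a) (hi : PolyTime i) :
    PolyTime (fun v => shift e (x v) (a v) (i v)) := by
  unfold RAM.shift
  fun_prop

theorem shift_eq (b : ℕ) {i : ℕ} (hi : i ≤ x.B ^ e) : shift e x b i = b * 2 ^ i :=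
  boundedRec_induction e x (fun k v => v = b * 2 ^ k) hi (by simp)
    (by rintro i v - rfl; ring)

theorem bit_eq (a : ℕ) {i : ℕ} (hi : i ≤ x.B ^ e) : bit e x a i = a / 2 ^ i % 2 := by
  have : boundedRec e x i a (fun _ v => v / 2) = a / 2 ^ i :=
    boundedRec_induction e x (fun k v => v = a / 2 ^ k) hi (by simp)
      (by rintro i v - rfl; rw [Nat.div_div_eq_div_mul, pow_succ])
  rw [bit, this]
  omega

/-- The product of `a` and `b`. -/
def mul (a b : ℕ) : ℕ := sum e x a fun i => if bit e x a i = 0 then 0 else shift e x b i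

@[fun_prop]
theorem PolyTime.mul {α : Type} [Enc α] {e : ℕ} {x : α → Ctx} {a b : α → ℕ}
    (hx : PolyTime x) (ha : PolyTime a) (hb : PolyTime b) :
    PolyTime (fun v => mul e (x v) (a v) (b v)) := by
  unfold RAM.mul
  fun_prop

/-- Binary long multiplication. Only the first factor is bounded; the second may be of any size,
which matters for the long products in `weight`. -/
theorem mul_eq {a : ℕ} (b : ℕ) (ha : a < 2 ^ x.B ^ e) : mul e x a b = a * b := by
  have key (k : ℕ) (hk : k ≤ x.B ^ e) : (∑ i ∈ Finset.range k,
      if bit e x a i = 0 then 0 else shift e x b i) = a % 2 ^ k * b := by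
    induction k with
    | zero => simp [Nat.mod_one]
    | succ k ih =>
      rw [Finset.sum_range_succ, ih (by omega), Nat.mod_pow_succ, bit_eq e x a (by omega),
        shift_eq e x b (by omega)]
      rcases Nat.mod_two_eq_zero_or_one (a / 2 ^ k) with h | h <;> simp [h]
      ring
  -- The loop makes `min a (x.B ^ e)` rounds. As `a` is less than `2 ^ a` and less than `2 ^ x.B ^
  -- e`, no bit of `a` is missed.
  have hs : mul e x a b = ∑ i ∈ Finset.range (min a (x.B ^ e)),
      if bit e x a i = 0 then 0 else shift e x b i := by
    rw [← sum_eq e x _ (min_le_right _ _)]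
    simp [mul, sum, boundedRec]
  rw [hs, key _ (min_le_right _ _), Nat.mod_eq_of_lt]
  rcases min_choice a (x.B ^ e) with h | h <;> rw [h]
  · exact Nat.lt_two_pow_self
  · exact ha

/-- The quotient of `a` by `b`. -/
def div (a b : ℕ) : ℕ := sum e x a fun i => if mul e x (i + 1) b ≤ a then 1 else 0

@[fun_prop]
theorem PolyTime.div {α : Type} [Enc α] {e : ℕ} {x : α → Ctx} {a b : α → ℕ}
    (hx : PolyTime x) (ha : PolyTime a) (hb : PolyTime b) :
    PolyTime (fun v => div e (x v) (a v) (b v)) := by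
  unfold RAM.div
  fun_prop

/-- The quotient is found by counting multiples, with as many rounds as `a`. This suffices, because
only the numbers of states and of steps have to be decoded. -/
theorem div_eq {a b : ℕ} (hb : 0 < b) (ha : a ≤ x.B ^ e) : div e x a b = a / b := by
  have h1 (i : ℕ) (hi : i < a) :
      (if mul e x (i + 1) b ≤ a then 1 else 0) = if i < a / b then 1 else 0 := by
    rw [mul_eq e x b (lt_of_le_of_lt (by omega) Nat.lt_two_pow_self)]
    simp only [← Nat.le_div_iff_mul_le hb, Nat.succ_le_iff]
  rw [div, sum_eq e x _ ha, Finset.sum_congr rfl fun i hi => h1 i (Finset.mem_range.1 hi),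
    ← Finset.sum_filter, Finset.sum_const, smul_eq_mul, mul_one]
  have : Finset.filter (fun i => i < a / b) (Finset.range a) = Finset.range (a / b) := by
    ext i
    have := Nat.div_le_self a b
    simp
    omega
  rw [this, Finset.card_range]

/-- The remainder of `a` modulo `b`. -/
def mod (a b : ℕ) : ℕ := a - mul e x (div e x a b) b

@[fun_prop]
theorem PolyTime.mod {α : Type} [Enc α] {e : ℕ} {x : α → Ctx} {a b : α → ℕ}
    (hx : PolyTime x) (ha : PolyTime a) (hb : PolyTime b) :
    PolyTime (fun v => mod e (x v) (a v) (b v)) := by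
  unfold RAM.mod
  fun_prop

theorem mod_eq {a b : ℕ} (hb : 0 < b) (ha : a ≤ x.B ^ e) : mod e x a b = a % b := by
  have h := Nat.div_add_mod' a b
  rw [mod, div_eq e x hb ha, mul_eq]
  · omega
  · exact lt_of_le_of_lt ((Nat.div_le_self _ _).trans ha) Nat.lt_two_pow_self

/-- The number whose bit `i` is `1` if and only if `f i ≠ 0`, for `i < n`. -/
def table (n : ℕ) (f : ℕ → ℕ) : ℕ :=
  boundedRec e x n 0 fun i v => v + v + if f (n - (i + 1)) = 0 then 0 else 1

@[fun_prop]
theorem PolyTime.table {α : Type} [Enc α] {e : ℕ} {x : α → Ctx} {n : α → ℕ} {f : α → ℕ → ℕ}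
    (hx : PolyTime x) (hn : PolyTime n) (hf : PolyTime (fun p : α × ℕ => f p.1 p.2)) :
    PolyTime (fun v => table e (x v) (n v) (f v)) := by
  have hf : PolyTime (fun s : α × ℕ × ℕ => f s.1 (n s.1 - (s.2.1 + 1))) :=
    hf.comp (f := fun s : α × ℕ × ℕ => (s.1, n s.1 - (s.2.1 + 1))) (by fun_prop)
  unfold RAM.table
  fun_prop

/-- A whole table is one natural number, so that it can be an ordinary value of a loop and no array
has to be maintained. Entries are appended at the low end from the last to the first: after `k`
rounds, bit `i` is entry `n - k + i`. -/
theorem bit_table {n : ℕ} (f : ℕ → ℕ) (hn : n ≤ x.B ^ e) {i : ℕ} (hi : i < n) :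
    bit e x (table e x n f) i = 0 ↔ f i = 0 := by
  have key := boundedRec_induction e x (n := n) (a := 0)
    (f := fun i v => v + v + if f (n - (i + 1)) = 0 then 0 else 1)
    (fun k v => ∀ i < k, v / 2 ^ i % 2 = 0 ↔ f (n - k + i) = 0) hn (by simp) (by
      intro k v hk ih i hi
      rcases i with _ | i
      · rw [pow_zero, Nat.div_one, add_zero]
        split_ifs with h <;> simp [h] <;> omega
      · rw [pow_succ', ← Nat.div_div_eq_div_mul,
          show (v + v + if f (n - (k + 1)) = 0 then 0 else 1) / 2 = v by split_ifs <;> omega,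
          ih i (by omega), show n - k + i = n - (k + 1) + (i + 1) by omega])
  rw [bit_eq e x _ (by omega)]
  have := key i hi
  rwa [Nat.sub_self, zero_add] at this

/-- Some `i < n` with `f i ≠ 0`, if there is one. -/
def find (n : ℕ) (f : ℕ → ℕ) : ℕ := boundedRec e x n 0 fun i v => if f i = 0 then v else i

@[fun_prop]
theorem PolyTime.find {α : Type} [Enc α] {e : ℕ} {x : α → Ctx} {n : α → ℕ} {f : α → ℕ → ℕ}
    (hx : PolyTime x) (hn : PolyTime n) (hf : PolyTime (fun p : α × ℕ => f p.1 p.2)) :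
    PolyTime (fun v => find e (x v) (n v) (f v)) := by
  have hf : PolyTime (fun s : α × ℕ × ℕ => f s.1 s.2.1) :=
    hf.comp (f := fun s : α × ℕ × ℕ => (s.1, s.2.1)) (by fun_prop)
  unfold RAM.find
  fun_prop

theorem find_spec {n : ℕ} {f : ℕ → ℕ} (hn : n ≤ x.B ^ e) (h : ∃ i < n, f i ≠ 0) :
    find e x n f < n ∧ f (find e x n f) ≠ 0 := by
  refine boundedRec_induction e x
    (fun k v => (∃ i < k, f i ≠ 0) → v < k ∧ f v ≠ 0) hn (by simp) ?_ h
  rintro k v - ih ⟨i, hi, hfi⟩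
  split_ifs with hk
  · have hik : i ≠ k := by rintro rfl; exact hfi hk
    have := ih ⟨i, by omega, hfi⟩
    exact ⟨by omega, this.2⟩
  · exact ⟨by omega, hk⟩

end RAM

/-! ## A dynamic program -/

namespace RAM

/-- From position `j` one can get to position `m` in `k` steps, where a step of type `r < T` from
`j` to `j'` has to satisfy `ok r j j'` and reduces the budget `κ` by `w r`, so that the budget is
used up in the end. -/
def Completable (m T : ℕ) (w : ℕ → ℕ) (ok : ℕ → ℕ → ℕ → Prop) : ℕ → ℕ → ℕ → Prop
  | 0, j, κ => j = m ∧ κ = 0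
  | k + 1, j, κ => ∃ r < T, ∃ j' ≤ m, (j ≤ j' ∧ w r ≤ κ ∧ ok r j j') ∧
      Completable m T w ok k j' (κ - w r)

section DynamicProgram

variable (e : ℕ) (x : Ctx) (m T N : ℕ) (w : ℕ → ℕ) (ok : ℕ → ℕ → ℕ → ℕ)

/-- Whether there is a step of type `r` from `j` to `j'` with budget `κ` to a state in the
table `tab`. -/
def stepTo (tab κ j r j' : ℕ) : ℕ :=
  if j ≤ j' then
    if w r ≤ κ then if ok r j j' = 0 then 0 else bit e x tab (mul e x (κ - w r) (m + 1) + j') else 0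
  else 0

/-- The table of the states `κ * (m + 1) + j` that are completable in `k` steps. -/
def completions (k : ℕ) : ℕ :=
  boundedRec e x k
    (table e x (mul e x (N + 1) (m + 1)) fun i => if i = m then 1 else 0) fun _ tab =>
      table e x (mul e x (N + 1) (m + 1)) fun i => sum e x T fun r => sum e x (m + 1) fun j' =>
        stepTo e x m w ok tab (div e x i (m + 1)) (mod e x i (m + 1)) r j'

/-- A step from the state `s` after which `k` steps suffice, as the number `r * (m + 1) + j'`. -/
def pick (k s : ℕ) : ℕ :=
  find e x (mul e x T (m + 1)) fun a =>
    stepTo e x m w ok (completions e x m T N w ok k) (div e x s (m + 1)) (mod e x s (m + 1))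
      (div e x a (m + 1)) (mod e x a (m + 1))

/-- The state after `i` of `n` steps. -/
def path (n i : ℕ) : ℕ :=
  boundedRec e x i (mul e x N (m + 1)) fun i s =>
    mul e x (div e x s (m + 1) - w (div e x (pick e x m T N w ok (n - (i + 1)) s) (m + 1))) (m + 1)
      + mod e x (pick e x m T N w ok (n - (i + 1)) s) (m + 1)

/-- The position after `i` of `n` steps. -/
def pathPos (n i : ℕ) : ℕ := mod e x (path e x m T N w ok n i) (m + 1)

/-- The type of step `i` of `n` steps. -/
def pathType (n i : ℕ) : ℕ :=
  div e x (pick e x m T N w ok (n - (i + 1)) (path e x m T N w ok n i)) (m + 1)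

end DynamicProgram

/-! ### The dynamic program takes polynomial time -/

namespace PolyTime

variable {α : Type} [Enc α] {e : ℕ} {x : α → Ctx} {m T N k n i s : α → ℕ} {w : α → ℕ → ℕ}
  {ok : α → ℕ → ℕ → ℕ → ℕ}

theorem stepTo {tab κ j r j' : α → ℕ} (hx : PolyTime x) (hm : PolyTime m)
    (hw : PolyTime (fun p : α × ℕ => w p.1 p.2))
    (hok : PolyTime (fun p : α × ℕ × ℕ × ℕ => ok p.1 p.2.1 p.2.2.1 p.2.2.2))
    (htab : PolyTime tab) (hκ : PolyTime κ) (hj : PolyTime j) (hr : PolyTime r)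
    (hj' : PolyTime j') : PolyTime (fun v =>
      stepTo e (x v) (m v) (w v) (ok v) (tab v) (κ v) (j v) (r v) (j' v)) := by
  have h1 : PolyTime (fun v => w v (r v)) := hw.comp (f := fun v => (v, r v)) (by fun_prop)
  have h2 : PolyTime (fun v => ok v (r v) (j v) (j' v)) :=
    hok.comp (f := fun v => (v, r v, j v, j' v)) (by fun_prop)
  unfold RAM.stepTo
  fun_prop

@[fun_prop]
theorem completions (hx : PolyTime x) (hm : PolyTime m) (hT : PolyTime T) (hN : PolyTime N)
    (hw : PolyTime (fun p : α × ℕ => w p.1 p.2))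
    (hok : PolyTime (fun p : α × ℕ × ℕ × ℕ => ok p.1 p.2.1 p.2.2.1 p.2.2.2))
    (hk : PolyTime k) : PolyTime (fun v =>
      completions e (x v) (m v) (T v) (N v) (w v) (ok v) (k v)) := by
  have h : PolyTime (fun q : (((α × ℕ × ℕ) × ℕ) × ℕ) × ℕ =>
      RAM.stepTo e (x q.1.1.1.1) (m q.1.1.1.1) (w q.1.1.1.1) (ok q.1.1.1.1) q.1.1.1.2.2
        (RAM.div e (x q.1.1.1.1) q.1.1.2 (m q.1.1.1.1 + 1))
        (RAM.mod e (x q.1.1.1.1) q.1.1.2 (m q.1.1.1.1 + 1)) q.1.2 q.2) := by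
    apply stepTo (x := fun q : (((α × ℕ × ℕ) × ℕ) × ℕ) × ℕ => x q.1.1.1.1)
      (m := fun q => m q.1.1.1.1) (w := fun q => w q.1.1.1.1) (ok := fun q => ok q.1.1.1.1)
    · fun_prop
    · fun_prop
    · exact hw.comp (f := fun q : ((((α × ℕ × ℕ) × ℕ) × ℕ) × ℕ) × ℕ => (q.1.1.1.1.1, q.2))
        (by fun_prop)
    · exact hok.comp (f := fun q : ((((α × ℕ × ℕ) × ℕ) × ℕ) × ℕ) × ℕ × ℕ × ℕ =>
        (q.1.1.1.1.1, q.2)) (by fun_prop)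
    all_goals fun_prop
  unfold RAM.completions
  fun_prop

@[fun_prop]
theorem pick (hx : PolyTime x) (hm : PolyTime m) (hT : PolyTime T) (hN : PolyTime N)
    (hw : PolyTime (fun p : α × ℕ => w p.1 p.2))
    (hok : PolyTime (fun p : α × ℕ × ℕ × ℕ => ok p.1 p.2.1 p.2.2.1 p.2.2.2))
    (hk : PolyTime k) (hs : PolyTime s) : PolyTime (fun v =>
      pick e (x v) (m v) (T v) (N v) (w v) (ok v) (k v) (s v)) := by
  have hc := completions (e := e) hx hm hT hN hw hok hk
  have h : PolyTime (fun q : α × ℕ =>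
      RAM.stepTo e (x q.1) (m q.1) (w q.1) (ok q.1)
        (RAM.completions e (x q.1) (m q.1) (T q.1) (N q.1) (w q.1) (ok q.1) (k q.1))
        (RAM.div e (x q.1) (s q.1) (m q.1 + 1)) (RAM.mod e (x q.1) (s q.1) (m q.1 + 1))
        (RAM.div e (x q.1) q.2 (m q.1 + 1)) (RAM.mod e (x q.1) q.2 (m q.1 + 1))) := by
    apply stepTo (x := fun q : α × ℕ => x q.1)
      (m := fun q => m q.1) (w := fun q => w q.1) (ok := fun q => ok q.1)
    · fun_prop
    · fun_prop
    · exact hw.comp (f := fun q : (α × ℕ) × ℕ => (q.1.1, q.2)) (by fun_prop)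
    · exact hok.comp (f := fun q : (α × ℕ) × ℕ × ℕ × ℕ => (q.1.1, q.2)) (by fun_prop)
    · exact hc.comp fst
    all_goals fun_prop
  unfold RAM.pick
  fun_prop

@[fun_prop]
theorem path (hx : PolyTime x) (hm : PolyTime m) (hT : PolyTime T) (hN : PolyTime N)
    (hw : PolyTime (fun p : α × ℕ => w p.1 p.2))
    (hok : PolyTime (fun p : α × ℕ × ℕ × ℕ => ok p.1 p.2.1 p.2.2.1 p.2.2.2))
    (hn : PolyTime n) (hi : PolyTime i) : PolyTime (fun v =>
      path e (x v) (m v) (T v) (N v) (w v) (ok v) (n v) (i v)) := by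
  have hp : PolyTime (fun q : α × ℕ × ℕ =>
      RAM.pick e (x q.1) (m q.1) (T q.1) (N q.1) (w q.1) (ok q.1) (n q.1 - (q.2.1 + 1)) q.2.2) := by
    apply pick (x := fun q : α × ℕ × ℕ => x q.1)
      (m := fun q => m q.1) (w := fun q => w q.1) (ok := fun q => ok q.1)
    · fun_prop
    · fun_prop
    · fun_prop
    · fun_prop
    · exact hw.comp (f := fun q : (α × ℕ × ℕ) × ℕ => (q.1.1, q.2)) (by fun_prop)
    · exact hok.comp (f := fun q : (α × ℕ × ℕ) × ℕ × ℕ × ℕ => (q.1.1, q.2)) (by fun_prop)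
    all_goals fun_prop
  have h : PolyTime (fun q : α × ℕ × ℕ => w q.1 (RAM.div e (x q.1) (RAM.pick e (x q.1) (m q.1)
      (T q.1) (N q.1) (w q.1) (ok q.1) (n q.1 - (q.2.1 + 1)) q.2.2) (m q.1 + 1))) :=
    hw.comp (f := fun q : α × ℕ × ℕ => (q.1, RAM.div e (x q.1) (RAM.pick e (x q.1) (m q.1)
      (T q.1) (N q.1) (w q.1) (ok q.1) (n q.1 - (q.2.1 + 1)) q.2.2) (m q.1 + 1))) (by fun_prop)
  unfold RAM.path
  fun_prop

@[fun_prop]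
theorem pathPos (hx : PolyTime x) (hm : PolyTime m) (hT : PolyTime T) (hN : PolyTime N)
    (hw : PolyTime (fun p : α × ℕ => w p.1 p.2))
    (hok : PolyTime (fun p : α × ℕ × ℕ × ℕ => ok p.1 p.2.1 p.2.2.1 p.2.2.2))
    (hn : PolyTime n) (hi : PolyTime i) : PolyTime (fun v =>
      pathPos e (x v) (m v) (T v) (N v) (w v) (ok v) (n v) (i v)) := by
  unfold RAM.pathPos
  fun_prop

@[fun_prop]
theorem pathType (hx : PolyTime x) (hm : PolyTime m) (hT : PolyTime T) (hN : PolyTime N)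
    (hw : PolyTime (fun p : α × ℕ => w p.1 p.2))
    (hok : PolyTime (fun p : α × ℕ × ℕ × ℕ => ok p.1 p.2.1 p.2.2.1 p.2.2.2))
    (hn : PolyTime n) (hi : PolyTime i) : PolyTime (fun v =>
      pathType e (x v) (m v) (T v) (N v) (w v) (ok v) (n v) (i v)) := by
  unfold RAM.pathType
  fun_prop

end PolyTime

/-! ### The dynamic program is correct -/

section Correctness

variable {e : ℕ} {x : Ctx} {m T N : ℕ} {w : ℕ → ℕ} {ok : ℕ → ℕ → ℕ → ℕ}

theorem lt_two_pow_of_le {a : ℕ} (h : a ≤ x.B ^ e) : a < 2 ^ x.B ^ e :=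
  lt_of_le_of_lt h Nat.lt_two_pow_self

theorem encode_lt {κ j : ℕ} (hκ : κ ≤ N) (hj : j ≤ m) : κ * (m + 1) + j < (N + 1) * (m + 1) := by
  have := Nat.mul_le_mul_right (m + 1) hκ
  rw [Nat.add_mul N, one_mul]
  omega

theorem encode_div {κ j : ℕ} (hj : j ≤ m) : (κ * (m + 1) + j) / (m + 1) = κ := by
  rw [mul_comm, Nat.mul_add_div (by omega), Nat.div_eq_of_lt (by omega), add_zero]

theorem encode_mod {κ j : ℕ} (hj : j ≤ m) : (κ * (m + 1) + j) % (m + 1) = j := by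
  rw [mul_comm, Nat.mul_add_mod, Nat.mod_eq_of_lt (by omega)]

variable (hW : (N + 1) * (m + 1) ≤ x.B ^ e)
include hW

theorem mul_budget (b : ℕ) {κ : ℕ} (hκ : κ ≤ N + 1) : mul e x κ b = κ * b := by
  refine mul_eq e x b (lt_two_pow_of_le (le_trans ?_ hW))
  exact hκ.trans (Nat.le_mul_of_pos_right _ (by omega))

theorem stepTo_ne_zero {tab κ j r j' : ℕ} (hκ : κ ≤ N) :
    stepTo e x m w ok tab κ j r j' ≠ 0 ↔ (j ≤ j' ∧ w r ≤ κ ∧ ok r j j' ≠ 0) ∧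
      bit e x tab ((κ - w r) * (m + 1) + j') ≠ 0 := by
  rw [stepTo, mul_budget hW _ (by omega)]
  split_ifs <;> simp_all

/-- Each round computes a table from the previous one by the recursion in `Completable`. The
hypotheses bound the number of states, of types and of rounds by the length of the loops. -/
theorem bit_completions (hT : T ≤ x.B ^ e) {k : ℕ} (hk : k ≤ x.B ^ e) {j κ : ℕ} (hj : j ≤ m)
    (hκ : κ ≤ N) : bit e x (completions e x m T N w ok k) (κ * (m + 1) + j) ≠ 0 ↔
      Completable m T w (fun r j j' => ok r j j' ≠ 0) k j κ := by
  have hm : m + 1 ≤ x.B ^ e := le_trans (Nat.le_mul_of_pos_left _ (by omega)) hW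
  refine boundedRec_induction e x (fun k v => ∀ j ≤ m, ∀ κ ≤ N, bit e x v (κ * (m + 1) + j) ≠ 0 ↔
    Completable m T w (fun r j j' => ok r j j' ≠ 0) k j κ) hk ?_ ?_ j hj κ hκ
  · intro j hj κ hκ
    rw [mul_budget hW _ le_rfl, Ne, bit_table e x _ hW (encode_lt hκ hj), Completable]
    -- The initial table contains only the number `m`. A positive budget makes the number at least
    -- `m + 1`, so this is the final state alone.
    rcases Nat.eq_zero_or_pos κ with rfl | h
    · simp
    · have := Nat.le_mul_of_pos_left (m + 1) h
      rw [if_neg (by omega)]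
      simp
      omega
  · intro i v hi ih j hj κ hκ
    have hlt := encode_lt hκ hj
    rw [mul_budget hW _ le_rfl, Ne, bit_table e x _ hW hlt,
      div_eq e x (by omega) (by omega), mod_eq e x (by omega) (by omega), encode_div hj,
      encode_mod hj, sum_eq e x _ hT, Finset.sum_eq_zero_iff, Completable]
    simp only [sum_eq e x _ hm, Finset.sum_eq_zero_iff]
    push Not
    constructor
    · rintro ⟨r, hr, j', hj', h⟩
      rw [Finset.mem_range] at hr hj'
      obtain ⟨h1, h2⟩ := (stepTo_ne_zero hW hκ).1 h
      exact ⟨r, hr, j', by omega, h1, (ih j' (by omega) _ (by omega)).1 h2⟩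
    · rintro ⟨r, hr, j', hj', h1, h2⟩
      exact ⟨r, Finset.mem_range.2 hr, j', Finset.mem_range.2 (by omega),
        (stepTo_ne_zero hW hκ).2 ⟨h1, (ih j' (by omega) _ (by omega)).2 h2⟩⟩

/-- Completability provides one candidate, so the search succeeds; the step that it finds may be
another one, but it also leads to a completable state. -/
theorem pick_spec (hT : T * (m + 1) ≤ x.B ^ e) {k : ℕ} (hk : k ≤ x.B ^ e) {j κ : ℕ} (hj : j ≤ m)
    (hκ : κ ≤ N) (h : Completable m T w (fun r j j' => ok r j j' ≠ 0) (k + 1) j κ) :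
    ∃ r < T, ∃ j' ≤ m, div e x (pick e x m T N w ok k (κ * (m + 1) + j)) (m + 1) = r ∧
      mod e x (pick e x m T N w ok k (κ * (m + 1) + j)) (m + 1) = j' ∧
      (j ≤ j' ∧ w r ≤ κ ∧ ok r j j' ≠ 0) ∧
      Completable m T w (fun r j j' => ok r j j' ≠ 0) k j' (κ - w r) := by
  have hT' : T ≤ x.B ^ e := le_trans (Nat.le_mul_of_pos_right _ (by omega)) hT
  obtain ⟨r, hr, j', hj', h1, h2⟩ := h
  have hlt := encode_lt hκ hj
  have hlt' : r * (m + 1) + j' < T * (m + 1) := by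
    have := encode_lt (N := T - 1) (show r ≤ T - 1 by omega) hj'
    rwa [Nat.sub_add_cancel (by omega)] at this
  have hmul : mul e x T (m + 1) = T * (m + 1) := mul_eq e x _ (lt_two_pow_of_le hT')
  obtain ⟨hp1, hp2⟩ := find_spec e x (n := mul e x T (m + 1)) (f := fun a =>
    stepTo e x m w ok (completions e x m T N w ok k) (div e x (κ * (m + 1) + j) (m + 1))
      (mod e x (κ * (m + 1) + j) (m + 1)) (div e x a (m + 1)) (mod e x a (m + 1)))
    (by rw [hmul]; exact hT) ⟨r * (m + 1) + j', by rw [hmul]; exact hlt', by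
      rw [div_eq e x (by omega) (by omega), mod_eq e x (by omega) (by omega), encode_div hj,
        encode_mod hj, div_eq e x (by omega) (by omega), mod_eq e x (by omega) (by omega),
        encode_div hj', encode_mod hj', stepTo_ne_zero hW hκ,
        bit_completions hW hT' hk hj' (by omega)]
      exact ⟨h1, h2⟩⟩
  rw [← pick.eq_1 e x m T N w ok k (κ * (m + 1) + j)] at hp1 hp2
  rw [hmul] at hp1
  generalize pick e x m T N w ok k (κ * (m + 1) + j) = a at hp1 hp2
  rw [div_eq e x (by omega) (by omega), mod_eq e x (by omega) (by omega), encode_div hj,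
    encode_mod hj, div_eq e x (by omega) (by omega), mod_eq e x (by omega) (by omega),
    stepTo_ne_zero hW hκ] at hp2
  have hmod := Nat.mod_lt a (show m + 1 > 0 by omega)
  rw [div_eq e x (by omega) (by omega), mod_eq e x (by omega) (by omega)]
  refine ⟨a / (m + 1), ?_, a % (m + 1), by omega, rfl, rfl, hp2.1,
    (bit_completions hW hT' hk (by omega) (by omega)).1 hp2.2⟩
  rw [Nat.div_lt_iff_lt_mul (by omega)]
  exact hp1

/-- Invariant along the path: after `i` steps the state is completable in `n - i` steps, and the
weights spent so far and the remaining budget add up to `N`. For `i = n` completability in `0` steps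
forces position `m` and budget `0`. -/
theorem path_spec (hT : T * (m + 1) ≤ x.B ^ e) {n : ℕ} (hn : n ≤ x.B ^ e)
    (h : Completable m T w (fun r j j' => ok r j j' ≠ 0) n 0 N) :
    pathPos e x m T N w ok n 0 = 0 ∧ pathPos e x m T N w ok n n = m ∧
    (∀ i < n, pathType e x m T N w ok n i < T ∧
      pathPos e x m T N w ok n i ≤ pathPos e x m T N w ok n (i + 1) ∧
      ok (pathType e x m T N w ok n i) (pathPos e x m T N w ok n i)
        (pathPos e x m T N w ok n (i + 1)) ≠ 0) ∧
    ∑ i ∈ Finset.range n, w (pathType e x m T N w ok n i) = N := by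
  have h0 : path e x m T N w ok n 0 = N * (m + 1) + 0 := by
    rw [path, boundedRec_zero, mul_budget hW _ (by omega), add_zero]
  have hpos {i j κ : ℕ} (hj : j ≤ m) (hκ : κ ≤ N)
      (h : path e x m T N w ok n i = κ * (m + 1) + j) : pathPos e x m T N w ok n i = j := by
    have := encode_lt hκ hj
    rw [pathPos, h, mod_eq e x (by omega) (by omega), encode_mod hj]
  have hstep {i j κ : ℕ} (hi : i < n) (hj : j ≤ m) (hκ : κ ≤ N)
      (h : path e x m T N w ok n i = κ * (m + 1) + j)
      (hc : Completable m T w (fun r j j' => ok r j j' ≠ 0) (n - i) j κ) :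
      ∃ r < T, ∃ j' ≤ m, pathType e x m T N w ok n i = r ∧
        path e x m T N w ok n (i + 1) = (κ - w r) * (m + 1) + j' ∧
        (j ≤ j' ∧ w r ≤ κ ∧ ok r j j' ≠ 0) ∧
        Completable m T w (fun r j j' => ok r j j' ≠ 0) (n - (i + 1)) j' (κ - w r) := by
    rw [show n - i = n - (i + 1) + 1 by omega] at hc
    obtain ⟨r, hr, j', hj', h1, h2, h3, h4⟩ := pick_spec hW hT (by omega) hj hκ hc
    have hlt := encode_lt hκ hj
    refine ⟨r, hr, j', hj', by rw [pathType, h, h1], ?_, h3, h4⟩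
    rw [path, boundedRec_succ e x _ _ (by omega), ← path.eq_1, h, h1, h2,
      div_eq e x (by omega) (by omega), encode_div hj, mul_budget hW _ (by omega)]
  have key : ∀ i ≤ n, ∃ κ ≤ N, ∃ j ≤ m, path e x m T N w ok n i = κ * (m + 1) + j ∧
      Completable m T w (fun r j j' => ok r j j' ≠ 0) (n - i) j κ ∧
      (∑ i ∈ Finset.range i, w (pathType e x m T N w ok n i)) + κ = N := by
    intro i
    induction i with
    | zero => exact fun _ => ⟨N, le_rfl, 0, by omega, h0, h, by simp⟩
    | succ i ih =>
      intro hi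
      obtain ⟨κ, hκ, j, hj, h1, h2, h3⟩ := ih (by omega)
      obtain ⟨r, hr, j', hj', h4, h5, h6, h7⟩ := hstep (by omega) hj hκ h1 h2
      refine ⟨κ - w r, by omega, j', hj', h5, h7, ?_⟩
      rw [Finset.sum_range_succ, h4]
      omega
  obtain ⟨κ, hκ, j, hj, h1, h2, h3⟩ := key n le_rfl
  rw [Nat.sub_self] at h2
  obtain ⟨rfl, rfl⟩ := h2
  refine ⟨hpos (by omega) le_rfl h0, hpos le_rfl hκ h1, fun i hi => ?_, h3⟩
  obtain ⟨κ, hκ, k, hk, h1, h2, -⟩ := key i hi.le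
  obtain ⟨r, hr, j', hj', h4, h5, h6, -⟩ := hstep hi hk hκ h1 h2
  rw [hpos hk hκ h1, hpos hj' (by omega) h5, h4]
  exact ⟨hr, h6.1, h6.2.2⟩

end Correctness

end RAM

/-! ## Splits of a cycle as sequences of arcs -/

namespace FairDivision

/-- The distance from `s` to `g` along the cycle on `0, …, m - 1`. -/
def cyclePos (m s g : ℕ) : ℕ := if s ≤ g then g - s else g + m - s

/-- The node on the cycle on `0, …, m - 1` that is represented by `p < 2 * m`. -/
def wrap (m p : ℕ) : ℕ := if m ≤ p then p - m else p

/-- The goods at distances `j, …, j' - 1` from `s`. -/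
def arc (m s j j' : ℕ) : Finset (Fin m) :=
  Finset.univ.filter fun g => j ≤ cyclePos m s g ∧ cyclePos m s g < j'

section Cycle

variable {m s : ℕ}

theorem cyclePos_lt {g : ℕ} (hs : s < m) (hg : g < m) : cyclePos m s g < m := by
  unfold cyclePos
  split_ifs <;> omega

theorem wrap_lt {p : ℕ} (hs : s < m) (hp : p < m) : wrap m (s + p) < m := by
  unfold wrap
  split_ifs <;> omega

theorem cyclePos_wrap {p : ℕ} (hs : s < m) (hp : p < m) : cyclePos m s (wrap m (s + p)) = p := by
  unfold cyclePos wrap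
  split_ifs <;> omega

theorem wrap_cyclePos {g : ℕ} (hs : s < m) (hg : g < m) : wrap m (s + cyclePos m s g) = g := by
  unfold cyclePos wrap
  split_ifs <;> omega

/-- The good at distance `p` from `s`. -/
def goodAt (hs : s < m) (p : ℕ) : Fin m :=
  ⟨wrap m (s + min p (m - 1)), wrap_lt hs (by omega)⟩

theorem val_goodAt (hs : s < m) {p : ℕ} (hp : p < m) : (goodAt hs p : ℕ) = wrap m (s + p) := by
  simp only [goodAt, min_eq_left (show p ≤ m - 1 by omega)]

theorem cyclePos_goodAt (hs : s < m) {p : ℕ} (hp : p < m) : cyclePos m s (goodAt hs p) = p := by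
  rw [val_goodAt hs hp, cyclePos_wrap hs hp]

theorem goodAt_cyclePos (hs : s < m) (g : Fin m) : goodAt hs (cyclePos m s g) = g := by
  ext
  rw [val_goodAt hs (cyclePos_lt hs g.2), wrap_cyclePos hs g.2]

theorem mem_arc {j j' : ℕ} {g : Fin m} :
    g ∈ arc m s j j' ↔ j ≤ cyclePos m s g ∧ cyclePos m s g < j' := by
  simp [arc]

theorem adj_goodAt_succ (hs : s < m) {p : ℕ} (hp : p + 1 < m) :
    (SimpleGraph.cycleGraph m).Adj (goodAt hs p) (goodAt hs (p + 1)) := by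
  rw [SimpleGraph.cycleGraph_adj']
  right
  have h1 := val_goodAt hs (show p < m by omega)
  have h2 := val_goodAt hs hp
  rw [Fin.sub_def, h1, h2]
  unfold wrap
  dsimp only
  split_ifs
  · rw [show m - (s + p - m) + (s + (p + 1) - m) = 1 + m by omega, Nat.add_mod_right,
      Nat.mod_eq_of_lt (by omega)]
  · omega
  · rw [show m - (s + p) + (s + (p + 1) - m) = 1 by omega, Nat.mod_eq_of_lt (by omega)]
  · rw [show m - (s + p) + (s + (p + 1)) = 1 + m by omega, Nat.add_mod_right,
      Nat.mod_eq_of_lt (by omega)]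

/-- In terms of distances from `s`, the cycle is a path with one additional edge between its ends
`0` and `m - 1`. -/
theorem cyclePos_of_adj (hs : s < m) {g h : Fin m} (hgh : (SimpleGraph.cycleGraph m).Adj g h) :
    cyclePos m s h = cyclePos m s g + 1 ∨ cyclePos m s g = cyclePos m s h + 1 ∨
      (cyclePos m s g = 0 ∧ cyclePos m s h = m - 1) ∨
      (cyclePos m s h = 0 ∧ cyclePos m s g = m - 1) := by
  have key : ∀ g h : Fin m, (g - h).val = 1 → (g : ℕ) = h + 1 ∨ ((g : ℕ) = 0 ∧ (h : ℕ) = m - 1) := by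
    intro g h hgh
    have hg := g.2
    have hh := h.2
    rw [Fin.sub_def] at hgh
    dsimp only at hgh
    by_cases hle : m ≤ m - h + g
    · rw [Nat.mod_eq_sub_mod hle, Nat.mod_eq_of_lt (by omega)] at hgh
      omega
    · rw [Nat.mod_eq_of_lt (by omega)] at hgh
      omega
  have hg := g.2
  have hh := h.2
  rw [SimpleGraph.cycleGraph_adj'] at hgh
  unfold cyclePos
  rcases hgh with hgh | hgh <;> have := key _ _ hgh <;> split_ifs <;> omega

theorem isBundle_arc (hs : s < m) {j j' : ℕ} (hj' : j' ≤ m) :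
    IsBundle (SimpleGraph.cycleGraph m) (arc m s j j') := by
  have mem (p : ℕ) (h1 : j ≤ p) (h2 : p < j') : goodAt hs p ∈ (arc m s j j' : Set (Fin m)) := by
    rw [Finset.mem_coe, mem_arc, cyclePos_goodAt hs (by omega)]
    exact ⟨h1, h2⟩
  have key (p k : ℕ) (h1 : j ≤ p) (h2 : p + k < j') :
      ((SimpleGraph.cycleGraph m).induce (arc m s j j' : Set (Fin m))).Reachable
        ⟨goodAt hs p, mem p h1 (by omega)⟩ ⟨goodAt hs (p + k), mem (p + k) (by omega) h2⟩ := by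
    induction k with
    | zero => exact SimpleGraph.Reachable.refl _
    | succ k ih =>
      refine (ih (by omega)).trans (SimpleGraph.Adj.reachable ?_)
      exact adj_goodAt_succ hs (by omega)
  have key' (g h : Fin m) (hg : g ∈ (arc m s j j' : Set (Fin m)))
      (hh : h ∈ (arc m s j j' : Set (Fin m))) (hle : cyclePos m s g ≤ cyclePos m s h) :
      ((SimpleGraph.cycleGraph m).induce (arc m s j j' : Set (Fin m))).Reachable
        ⟨g, hg⟩ ⟨h, hh⟩ := by
    have h1 := mem_arc.1 (Finset.mem_coe.1 hg)
    have h2 := mem_arc.1 (Finset.mem_coe.1 hh)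
    have := key (cyclePos m s g) (cyclePos m s h - cyclePos m s g) h1.1 (by omega)
    simp only [Nat.add_sub_cancel' hle, goodAt_cyclePos] at this
    exact this
  rintro ⟨g, hg⟩ ⟨h, hh⟩
  rcases le_total (cyclePos m s g) (cyclePos m s h) with hle | hle
  · exact key' g h hg hh hle
  · exact (key' h g hh hg hle).symm

/-- A bundle that misses an end of the path cannot use the edge that closes the cycle. Hence a walk
inside it changes the distance by one at a time and cannot pass from below `y` to above `y` without
meeting `y`. -/
theorem bundle_convex (hs : s < m) {S : Finset (Fin m)}
    (hS : IsBundle (SimpleGraph.cycleGraph m) S)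
    (hne : goodAt hs 0 ∉ S ∨ goodAt hs (m - 1) ∉ S) {a y b : ℕ} (hay : a < y) (hyb : y < b)
    (hb : b < m) (ha' : goodAt hs a ∈ S) (hb' : goodAt hs b ∈ S) : goodAt hs y ∈ S := by
  by_contra hy
  obtain ⟨W⟩ := hS ⟨goodAt hs a, ha'⟩ ⟨goodAt hs b, hb'⟩
  have key : ∀ (u v : (S : Set (Fin m))),
      ((SimpleGraph.cycleGraph m).induce (S : Set (Fin m))).Walk u v →
      cyclePos m s u.1 < y → cyclePos m s v.1 < y := by
    intro u v W
    induction W with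
    | nil => exact fun h => h
    | @cons u v z huv W ih =>
      intro hu
      refine ih ?_
      have hvy : cyclePos m s v.1 ≠ y := by
        rintro rfl
        rw [goodAt_cyclePos] at hy
        exact hy v.2
      rcases cyclePos_of_adj hs (show (SimpleGraph.cycleGraph m).Adj u.1 v.1 from huv) with
        h | h | ⟨h, h'⟩ | ⟨h, h'⟩
      · omega
      · omega
      · rw [← h, ← h', goodAt_cyclePos, goodAt_cyclePos] at hne
        exact (hne.elim (fun h => h u.2) (fun h => h v.2)).elim
      · omega
  have := key _ _ W (by rwa [cyclePos_goodAt hs (by omega)])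
  rw [cyclePos_goodAt hs hb] at this
  omega

/-- A cycle can be cut so that every bundle of a split is convex. -/
theorem exists_cut (hm : 0 < m) {ι : Type} {P : ι → Finset (Fin m)}
    (hP : IsSplit (SimpleGraph.cycleGraph m) P) :
    ∃ (s : ℕ) (hs : s < m), ∀ i a y b, a ≤ y → y ≤ b → b < m → goodAt hs a ∈ P i →
      goodAt hs b ∈ P i → goodAt hs y ∈ P i := by
  obtain ⟨hB, hD, hC⟩ := hP
  -- A good cut separates two neighbours that no bundle has in common. If there is none, any two
  -- neighbours share a bundle, so a single bundle contains all goods and every cut will do.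
  by_cases h : ∃ (s : ℕ) (hs : s < m), ∀ i, goodAt hs 0 ∉ P i ∨ goodAt hs (m - 1) ∉ P i
  · obtain ⟨s, hs, h⟩ := h
    refine ⟨s, hs, fun i a y b hay hyb hb ha' hb' => ?_⟩
    rcases hay.eq_or_lt with rfl | hay
    · exact ha'
    rcases hyb.eq_or_lt with rfl | hyb
    · exact hb'
    exact bundle_convex hs (hB i) (h i) hay hyb hb ha' hb'
  · push Not at h
    obtain ⟨i, hi⟩ := hC (⟨0, hm⟩ : Fin m)
    have key (k : ℕ) (hk : k < m) : (⟨k, hk⟩ : Fin m) ∈ P i := by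
      induction k with
      | zero => exact hi
      | succ k ih =>
        obtain ⟨i', h1, h2⟩ := h (k + 1) hk
        have e1 : goodAt hk 0 = ⟨k + 1, hk⟩ := by
          ext
          rw [val_goodAt hk hm, wrap, if_neg (by omega)]
        have e2 : goodAt hk (m - 1) = ⟨k, by omega⟩ := by
          ext
          rw [val_goodAt hk (by omega), wrap, if_pos (by omega)]
          dsimp only
          omega
        rw [e1] at h1
        rw [e2] at h2
        have : i' = i := by
          by_contra hne
          exact Finset.disjoint_left.1 (hD i' i hne) h2 (ih (by omega))
        exact this ▸ h1
    refine ⟨0, hm, fun i' a y b _ _ _ ha' _ => ?_⟩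
    have : i' = i := by
      by_contra hne
      exact Finset.disjoint_left.1 (hD i' i hne) ha' (key _ _)
    exact this ▸ key _ _

-- The cut depends on the split alone and is therefore chosen before weights, tests and types. The
-- induction is over the set `R` of bundles not yet used: they lie at distances from `j` on, and
-- every good there belongs to one of them.
open RAM in
theorem completable_of_split (hm : 0 < m) {ι : Type} [Fintype ι] {P : ι → Finset (Fin m)}
    (hP : IsSplit (SimpleGraph.cycleGraph m) P) :
    ∃ s < m, ∀ (T : ℕ) (w : ℕ → ℕ) (ok : ℕ → ℕ → ℕ → Prop) (ty : ι → ℕ), (∀ i, ty i < T) →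
      (∀ i j j', j ≤ j' → j' ≤ m → P i = arc m s j j' → ok (ty i) j j') →
      Completable m T w ok (Fintype.card ι) 0 (∑ i, w (ty i)) := by
  classical
  obtain ⟨s, hs, hconv⟩ := exists_cut hm hP
  obtain ⟨hB, hD, hC⟩ := hP
  refine ⟨s, hs, fun T w ok ty hty hok => ?_⟩
  have uniq {i i' : ι} {g : Fin m} (h : g ∈ P i) (h' : g ∈ P i') : i = i' := by
    by_contra hne
    exact Finset.disjoint_left.1 (hD i i' hne) h h'
  have hpos (g : Fin m) : cyclePos m s g < m := cyclePos_lt hs g.2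
  have key : ∀ (k : ℕ) (R : Finset ι) (j : ℕ), R.card = k → j ≤ m →
      (∀ i ∈ R, ∀ g ∈ P i, j ≤ cyclePos m s g) →
      (∀ i g, g ∈ P i → j ≤ cyclePos m s g → i ∈ R) →
      Completable m T w ok k j (∑ i ∈ R, w (ty i)) := by
    intro k
    induction k with
    | zero =>
      intro R j hR hj h1 h2
      rw [Finset.card_eq_zero] at hR
      subst hR
      refine ⟨?_, rfl⟩
      by_contra hne
      obtain ⟨i, hi⟩ := hC (goodAt hs j)
      have := h2 i _ hi (by rw [cyclePos_goodAt hs (by omega)])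
      simp at this
    | succ k ih =>
      intro R j hR hj h1 h2
      suffices h : ∃ i ∈ R, ∃ j' ≤ m, j ≤ j' ∧ P i = arc m s j j' by
        obtain ⟨i, hi, j', hj', hjj', hPi⟩ := h
        have hsum := Finset.sum_erase_add R (fun i => w (ty i)) hi
        refine ⟨ty i, hty i, j', hj', ⟨hjj', by omega, hok i j j' hjj' hj' hPi⟩, ?_⟩
        rw [← hsum, Nat.add_sub_cancel]
        refine ih _ _ (by rw [Finset.card_erase_of_mem hi, hR, Nat.add_sub_cancel]) hj' ?_ ?_
        · intro i' hi' g hg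
          obtain ⟨hne, hi'⟩ := Finset.mem_erase.1 hi'
          by_contra hlt
          have : g ∈ P i := by
            rw [hPi, mem_arc]
            exact ⟨h1 i' hi' g hg, by omega⟩
          exact hne (uniq hg this)
        · intro i' g hg hle
          refine Finset.mem_erase.2 ⟨?_, h2 i' g hg (by omega)⟩
          rintro rfl
          rw [hPi, mem_arc] at hg
          omega
      -- Empty bundles can be placed anywhere and are used up at once, as steps from `j` to `j`.
      -- When none is left, the next bundle is the one that contains the good at distance `j`; by
      -- convexity it is an arc that begins there.
      by_cases hemp : ∃ i ∈ R, P i = ∅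
      · obtain ⟨i, hi, hPi⟩ := hemp
        refine ⟨i, hi, j, hj, le_rfl, ?_⟩
        rw [hPi, eq_comm, Finset.eq_empty_iff_forall_notMem]
        intro g hg
        rw [mem_arc] at hg
        omega
      · push Not at hemp
        obtain ⟨i₀, hi₀⟩ := Finset.card_pos.1 (show 0 < R.card by omega)
        obtain ⟨g₀, hg₀⟩ := hemp i₀ hi₀
        have hjm : j < m := lt_of_le_of_lt (h1 i₀ hi₀ g₀ hg₀) (hpos g₀)
        obtain ⟨i, hi⟩ := hC (goodAt hs j)
        have hiR := h2 i _ hi (by rw [cyclePos_goodAt hs hjm])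
        obtain ⟨g, hg, hmax⟩ := Finset.exists_max_image (P i) (fun g => cyclePos m s g) ⟨_, hi⟩
        have hjg := hmax _ hi
        rw [cyclePos_goodAt hs hjm] at hjg
        refine ⟨i, hiR, cyclePos m s g + 1, hpos g, by omega, ?_⟩
        ext h
        rw [mem_arc]
        constructor
        · intro hh
          exact ⟨h1 i hiR h hh, by have := hmax h hh; omega⟩
        · rintro ⟨h3, h4⟩
          rw [← goodAt_cyclePos hs h]
          refine hconv i j _ (cyclePos m s g) h3 (by omega) (hpos g) hi ?_
          rwa [goodAt_cyclePos]
  exact key _ Finset.univ 0 rfl (Nat.zero_le _) (fun _ _ _ _ => Nat.zero_le _)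
    (fun _ _ _ _ => Finset.mem_univ _)

end Cycle

/-! ## Allocations from sequences of steps -/

/-- Makes the encoding of multisets of agents by numbers faithful. The lowest digit is the remainder
modulo `b`, and the rest follows by induction. -/
theorem digits_unique {b T : ℕ} {A C : Fin T → ℕ} (hA : ∀ q, A q < b) (hC : ∀ q, C q < b)
    (h : ∑ q, A q * b ^ (q : ℕ) = ∑ q, C q * b ^ (q : ℕ)) : A = C := by
  induction T with
  | zero => exact Subsingleton.elim _ _
  | succ T ih =>
    have e (A : Fin (T + 1) → ℕ) :
        ∑ q, A q * b ^ (q : ℕ) = A 0 + b * ∑ q : Fin T, A q.succ * b ^ (q : ℕ) := by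
      rw [Fin.sum_univ_succ, Finset.mul_sum]
      congr 1
      · simp
      · refine Finset.sum_congr rfl fun q _ => ?_
        rw [Fin.val_succ, pow_succ]
        ring
    rw [e, e] at h
    have h0 : A 0 = C 0 := by
      have := congrArg (· % b) h
      simpa [Nat.add_mul_mod_self_left, Nat.mod_eq_of_lt, hA, hC] using this
    have hb : 0 < b := lt_of_le_of_lt (Nat.zero_le _) (hA 0)
    have h1 := ih (A := fun q => A q.succ) (C := fun q => C q.succ) (fun q => hA _)
      (fun q => hC _) (Nat.eq_of_mul_eq_mul_left hb (by omega))
    funext q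
    refine Fin.cases h0 (fun q => ?_) q
    exact congrFun h1 q

/-- Finds the step that belongs to agent `k` of a type: the one that is preceded by `k` steps of
this type. -/
theorem exists_count_eq {p : ℕ → Prop} [DecidablePred p] {n k : ℕ} (h : k < Nat.count p n) :
    ∃ i < n, p i ∧ Nat.count p i = k := by
  induction n with
  | zero => simp at h
  | succ n ih =>
    by_cases hk : k < Nat.count p n
    · obtain ⟨i, hi, h'⟩ := ih hk
      exact ⟨i, by omega, h'⟩
    · rw [Nat.count_succ] at h
      split_ifs at h with hp
      · exact ⟨n, by omega, hp, by omega⟩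
      · omega

theorem sigma_fin_ext {T : ℕ} {cnt : Fin T → ℕ} {a b : Σ q : Fin T, Fin (cnt q)}
    (h1 : (a.1 : ℕ) = b.1) (h2 : (a.2 : ℕ) = b.2) : a = b := by
  obtain ⟨a1, a2⟩ := a
  obtain ⟨b1, b2⟩ := b
  obtain rfl : a1 = b1 := Fin.ext h1
  obtain rfl : a2 = b2 := Fin.ext h2
  rfl

/-- The step that contains `p` is preceded precisely by the steps that end at or before `p`, empty
ones included. This lets the algorithm compute its index as a sum. -/
theorem card_steps_eq {n : ℕ} {c : ℕ → ℕ} (hmono : ∀ i < n, c i ≤ c (i + 1)) {i p : ℕ} (hi : i < n)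
    (h1 : c i ≤ p) (h2 : p < c (i + 1)) :
    (∑ k ∈ Finset.range n, if c (k + 1) ≤ p then 1 else 0) = i := by
  have mono (a k : ℕ) (h : a + k ≤ n) : c a ≤ c (a + k) := by
    induction k with
    | zero => exact le_rfl
    | succ k ih => exact (ih (by omega)).trans (hmono (a + k) (by omega))
  have : (Finset.range n).filter (fun k => c (k + 1) ≤ p) = Finset.range i := by
    ext k
    rw [Finset.mem_filter, Finset.mem_range, Finset.mem_range]
    constructor
    · rintro ⟨hk, hle⟩
      by_contra hik
      have := mono (i + 1) (k - i) (by omega)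
      rw [show i + 1 + (k - i) = k + 1 by omega] at this
      omega
    · intro hk
      have := mono (k + 1) (i - (k + 1)) (by omega)
      rw [show k + 1 + (i - (k + 1)) = i by omega] at this
      exact ⟨by omega, by omega⟩
  rw [← Finset.sum_filter, this]
  simp

theorem exists_step {n : ℕ} {c : ℕ → ℕ} {p : ℕ} (h0 : c 0 ≤ p) (hn : p < c n) :
    ∃ i < n, c i ≤ p ∧ p < c (i + 1) := by
  induction n with
  | zero => omega
  | succ n ih =>
    by_cases h : c n ≤ p
    · exact ⟨n, by omega, h, hn⟩
    · obtain ⟨i, hi, h'⟩ := ih (by omega)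
      exact ⟨i, by omega, h'⟩

/-- A sequence of `n` steps with types `r i` from position `c i` to `c (i + 1)` gives an allocation
of arcs to the agents. -/
theorem exists_allocation {m s T n b : ℕ} (hs : s < m) {cnt : Fin T → ℕ} (hn : n = ∑ q, cnt q)
    (hb : n < b) {r c : ℕ → ℕ} (h0 : c 0 = 0) (hcn : c n = m)
    (hmono : ∀ i < n, c i ≤ c (i + 1)) (hr : ∀ i < n, r i < T)
    (hsum : ∑ i ∈ Finset.range n, b ^ r i = ∑ q, cnt q * b ^ (q : ℕ)) :
    ∃ f : Fin m → Σ q : Fin T, Fin (cnt q),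
      (∀ g : Fin m, ∀ i, i = (∑ k ∈ Finset.range n, if c (k + 1) ≤ cyclePos m s g then 1 else 0) →
        ((f g).1 : ℕ) = r i ∧
        ((f g).2 : ℕ) = ∑ k ∈ Finset.range i, if r k = r i then 1 else 0) ∧
      ∀ a, ∃ i < n, r i = a.1 ∧ bundlesOf f a = arc m s (c i) (c (i + 1)) := by
  -- A step only has to have a weight that does not exceed the budget; it may borrow from higher
  -- digits, so nothing in a single step ensures that an agent of its type is left. But there are
  -- only `n < b` steps, so the numbers of steps of the types are digits in base `b`, and equal sums
  -- have equal digits.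
  have hcount (q : Fin T) : Nat.count (fun k => r k = q) n = cnt q := by
    have := digits_unique (b := b) (A := fun q : Fin T => Nat.count (fun k => r k = q) n) (C := cnt)
      (fun q => lt_of_le_of_lt (Nat.count_le ..) hb)
      (fun q => lt_of_le_of_lt (hn ▸ Finset.single_le_sum (f := cnt)
        (fun _ _ => Nat.zero_le _) (Finset.mem_univ q)) hb) (by
        rw [← hsum]
        simp only [Nat.count_eq_card_filter_range, Finset.card_filter, Finset.sum_mul]
        rw [Finset.sum_comm]
        refine Finset.sum_congr rfl fun i hi => ?_
        rw [Finset.sum_eq_single (⟨r i, hr i (Finset.mem_range.1 hi)⟩ : Fin T)]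
        · simp
        · intro q _ hq
          rw [if_neg, zero_mul]
          intro h
          exact hq (Fin.ext h.symm)
        · simp)
    exact congrFun this q
  have hstep (g : Fin m) : ∃ i < n, c i ≤ cyclePos m s g ∧ cyclePos m s g < c (i + 1) :=
    exists_step (by omega) (by rw [hcn]; exact cyclePos_lt hs g.2)
  choose st hst1 hst2 using hstep
  have hrank (i : ℕ) (hi : i < n) :
      Nat.count (fun k => r k = r i) i < cnt ⟨r i, hr i hi⟩ := by
    rw [← hcount]
    exact Nat.count_strict_mono (p := fun k => r k = r i) rfl hi
  -- Agents of one type are numbered by the order of their steps, so a good goes to the agent whose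
  -- index is the number of earlier steps of the same type.
  refine ⟨fun g => ⟨⟨r (st g), hr _ (hst1 g)⟩, ⟨_, hrank _ (hst1 g)⟩⟩, ?_, ?_⟩
  · intro g i hi
    rw [card_steps_eq hmono (hst1 g) (hst2 g).1 (hst2 g).2] at hi
    subst hi
    refine ⟨rfl, ?_⟩
    change Nat.count (fun k => r k = r (st g)) (st g) = _
    rw [Nat.count_eq_card_filter_range, Finset.card_filter]
  · rintro ⟨q, k⟩
    obtain ⟨i, hi, hri, hk⟩ := exists_count_eq (p := fun k => r k = q) (k := k) (n := n)
      (by rw [hcount]; exact k.2)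
    refine ⟨i, hi, hri, ?_⟩
    ext g
    rw [mem_arc, bundlesOf, Finset.mem_filter]
    simp only [Finset.mem_univ, true_and]
    constructor
    · intro h
      have h1 : r (st g) = q := congrArg (fun a => (a.1 : ℕ)) h
      have h2 : Nat.count (fun k => r k = r (st g)) (st g) = k := by
        have := congrArg (fun a : Σ q : Fin T, Fin (cnt q) => (a.2 : ℕ)) h
        exact this
      simp only [h1] at h2
      have : st g = i := Nat.count_injective (p := fun k => r k = q) h1 hri (by rw [h2, hk])
      exact this ▸ hst2 g
    · rintro ⟨h1, h2⟩
      have : st g = i := by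
        rw [← card_steps_eq hmono (hst1 g) (hst2 g).1 (hst2 g).2, card_steps_eq hmono hi h1 h2]
      refine sigma_fin_ext ?_ ?_
      · change r (st g) = q
        rw [this, hri]
      · change Nat.count (fun k => r k = r (st g)) (st g) = k
        rw [this]
        simp only [hri, hk]

end FairDivision

/-! ## The algorithm -/

namespace RAM

open FairDivision

section Algorithm

variable (t : ℕ) (x : Ctx)

/-- The value of good `j` for agents of type `r`, multiplied by all denominators of this type. -/
def weight (r j : ℕ) : ℕ :=
  boundedRec (t + 1) x (x.inp 0) 1 fun k v =>
    mul (t + 1) x (x.inp (1 + mul (t + 1) x r (x.inp 0 + x.inp 0) + (k + k) +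
      if k = j then 0 else 1)) v

/-- The number of agents of type `r`. -/
def count (r : ℕ) : ℕ := x.inp (1 + mul (t + 1) x t (x.inp 0 + x.inp 0) + r)

/-- The number of agents. -/
def agents : ℕ := sum (t + 1) x t fun r => count t x r

/-- The weight of an agent of type `r` in the number that encodes a multiset of agents. -/
def stride (r : ℕ) : ℕ :=
  boundedRec (t + 1) x r 1 fun _ v => mul (t + 1) x (agents t x + 1) v

/-- The number that encodes the multiset of all agents. -/
def budget : ℕ := sum (t + 1) x t fun r => mul (t + 1) x (count t x r) (stride t x r)

/-- The value of an arc for agents of type `r`. -/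
def arcValue (r s j j' : ℕ) : ℕ :=
  sum (t + 1) x (j' - j) fun i => weight t x r (wrap (x.inp 0) (s + (j + i)))

/-- Whether the arc is worth at least `q` for agents of type `r`. -/
def atLeast (r q s j j' : ℕ) : ℕ := if q ≤ arcValue t x r s j j' then 1 else 0

/-- Whether there is a split with bundles that are worth at least `q` for agents of type `r`. -/
def isLevel (r q : ℕ) : ℕ :=
  sum (t + 1) x (x.inp 0) fun s =>
    bit (t + 1) x (completions (t + 1) x (x.inp 0) 1 (agents t x) (stride t x)
      (fun _ j j' => atLeast t x r q s j j') (agents t x))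
      (mul (t + 1) x (agents t x) (x.inp 0 + 1))

/-- The number of arcs that are worth more than `v` for agents of type `r`, although the
maximin share is at least their value. -/
def deficiency (r v : ℕ) : ℕ :=
  sum (t + 1) x (x.inp 0) fun s => sum (t + 1) x (x.inp 0 + 1) fun j =>
    sum (t + 1) x (x.inp 0 + 1) fun j' =>
      if arcValue t x r s j j' ≤ v then 0
      else if isLevel t x r (arcValue t x r s j j') = 0 then 0 else 1

/-- Whether the arc is worth the maximin share for agents of type `r`. -/
def isFair (s r j j' : ℕ) : ℕ :=
  if deficiency t x r (arcValue t x r s j j') = 0 then 1 else 0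

/-- Whether there is an allocation by arcs that do not contain `s` in their interior. -/
def isCut (s : ℕ) : ℕ :=
  bit (t + 1) x (completions (t + 1) x (x.inp 0) t (budget t x) (stride t x) (isFair t x s)
    (agents t x)) (mul (t + 1) x (budget t x) (x.inp 0 + 1))

/-- Where to cut the cycle. -/
def cut : ℕ := find (t + 1) x (x.inp 0) (isCut t x)

/-- The type of the agent who receives bundle `i`. -/
def bundleType (i : ℕ) : ℕ :=
  pathType (t + 1) x (x.inp 0) t (budget t x) (stride t x) (isFair t x (cut t x)) (agents t x) i

/-- Where bundle `i` begins. -/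
def bundlePos (i : ℕ) : ℕ :=
  pathPos (t + 1) x (x.inp 0) t (budget t x) (stride t x) (isFair t x (cut t x)) (agents t x) i

/-- The index of the bundle that contains good `g`. -/
def bundleIndex (g : ℕ) : ℕ :=
  sum (t + 1) x (agents t x) fun k =>
    if bundlePos t x (k + 1) ≤ cyclePos (x.inp 0) (cut t x) g then 1 else 0

/-- The index of the agent who receives bundle `i` among the agents of the same type. -/
def bundleRank (i : ℕ) : ℕ :=
  sum (t + 1) x i fun k => if bundleType t x k = bundleType t x i then 1 else 0

/-- Whether an allocation exists if there are at most as many agents as goods. -/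
def isSolvable : ℕ := sum (t + 1) x (x.inp 0) (isCut t x)

/-- The length of the output. -/
def outputLength : ℕ :=
  if agents t x ≤ x.inp 0 then
    if isSolvable t x = 0 then 1 else 1 + (x.inp 0 + x.inp 0)
  else 1 + (x.inp 0 + x.inp 0)

/-- The output at position `1 + i`, if there is an allocation. -/
def outputEntry (i : ℕ) : ℕ :=
  if agents t x ≤ x.inp 0 then
    if i - (i / 2 + i / 2) = 0 then bundleType t x (bundleIndex t x (i / 2))
    else bundleRank t x (bundleIndex t x (i / 2))
  else if i - (i / 2 + i / 2) = 0 then find (t + 1) x t (count t x) else 0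

/-- The output at position `i`. -/
def output (i : ℕ) : ℕ :=
  if i = 0 then
    if agents t x ≤ x.inp 0 then if isSolvable t x = 0 then 0 else 1 else 1
  else outputEntry t x (i - 1)

end Algorithm

/-! ### The algorithm takes polynomial time -/

namespace PolyTime

variable {α : Type} [Enc α] {t : ℕ} {x : α → Ctx} {r j j' s q i v : α → ℕ}

@[fun_prop]
theorem wrap {m p : α → ℕ} (hm : PolyTime m) (hp : PolyTime p) :
    PolyTime (fun a => wrap (m a) (p a)) := by
  unfold FairDivision.wrap
  fun_prop

@[fun_prop]
theorem cyclePos {m s g : α → ℕ} (hm : PolyTime m) (hs : PolyTime s) (hg : PolyTime g) :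
    PolyTime (fun a => cyclePos (m a) (s a) (g a)) := by
  unfold FairDivision.cyclePos
  fun_prop

@[fun_prop]
theorem weight (hx : PolyTime x) (hr : PolyTime r) (hj : PolyTime j) :
    PolyTime (fun a => weight t (x a) (r a) (j a)) := by
  unfold RAM.weight
  fun_prop

@[fun_prop]
theorem count (hx : PolyTime x) (hr : PolyTime r) : PolyTime (fun a => count t (x a) (r a)) := by
  unfold RAM.count
  fun_prop

@[fun_prop]
theorem agents (hx : PolyTime x) : PolyTime (fun a => agents t (x a)) := by
  unfold RAM.agents
  fun_prop

@[fun_prop]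
theorem stride (hx : PolyTime x) (hr : PolyTime r) :
    PolyTime (fun a => stride t (x a) (r a)) := by
  unfold RAM.stride
  fun_prop

@[fun_prop]
theorem budget (hx : PolyTime x) : PolyTime (fun a => budget t (x a)) := by
  unfold RAM.budget
  fun_prop

@[fun_prop]
theorem arcValue (hx : PolyTime x) (hr : PolyTime r) (hs : PolyTime s) (hj : PolyTime j)
    (hj' : PolyTime j') : PolyTime (fun a => arcValue t (x a) (r a) (s a) (j a) (j' a)) := by
  unfold RAM.arcValue
  fun_prop

@[fun_prop]
theorem atLeast (hx : PolyTime x) (hr : PolyTime r) (hq : PolyTime q) (hs : PolyTime s)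
    (hj : PolyTime j) (hj' : PolyTime j') :
    PolyTime (fun a => atLeast t (x a) (r a) (q a) (s a) (j a) (j' a)) := by
  unfold RAM.atLeast
  fun_prop

@[fun_prop]
theorem isLevel (hx : PolyTime x) (hr : PolyTime r) (hq : PolyTime q) :
    PolyTime (fun a => isLevel t (x a) (r a) (q a)) := by
  unfold RAM.isLevel
  fun_prop

@[fun_prop]
theorem deficiency (hx : PolyTime x) (hr : PolyTime r) (hv : PolyTime v) :
    PolyTime (fun a => deficiency t (x a) (r a) (v a)) := by
  unfold RAM.deficiency
  fun_prop

@[fun_prop]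
theorem isFair (hx : PolyTime x) (hs : PolyTime s) (hr : PolyTime r) (hj : PolyTime j)
    (hj' : PolyTime j') : PolyTime (fun a => isFair t (x a) (s a) (r a) (j a) (j' a)) := by
  unfold RAM.isFair
  fun_prop

@[fun_prop]
theorem isCut (hx : PolyTime x) (hs : PolyTime s) : PolyTime (fun a => isCut t (x a) (s a)) := by
  unfold RAM.isCut
  fun_prop

@[fun_prop]
theorem cut (hx : PolyTime x) : PolyTime (fun a => cut t (x a)) := by
  unfold RAM.cut
  fun_prop

@[fun_prop]
theorem bundleType (hx : PolyTime x) (hi : PolyTime i) :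
    PolyTime (fun a => bundleType t (x a) (i a)) := by
  unfold RAM.bundleType
  fun_prop

@[fun_prop]
theorem bundlePos (hx : PolyTime x) (hi : PolyTime i) :
    PolyTime (fun a => bundlePos t (x a) (i a)) := by
  unfold RAM.bundlePos
  fun_prop

@[fun_prop]
theorem bundleIndex (hx : PolyTime x) (hi : PolyTime i) :
    PolyTime (fun a => bundleIndex t (x a) (i a)) := by
  unfold RAM.bundleIndex
  fun_prop

@[fun_prop]
theorem bundleRank (hx : PolyTime x) (hi : PolyTime i) :
    PolyTime (fun a => bundleRank t (x a) (i a)) := by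
  unfold RAM.bundleRank
  fun_prop

@[fun_prop]
theorem isSolvable (hx : PolyTime x) : PolyTime (fun a => isSolvable t (x a)) := by
  unfold RAM.isSolvable
  fun_prop

theorem outputLength : PolyTime (outputLength t) := by
  unfold RAM.outputLength
  fun_prop

@[fun_prop]
theorem outputEntry (hx : PolyTime x) (hi : PolyTime i) :
    PolyTime (fun a => outputEntry t (x a) (i a)) := by
  unfold RAM.outputEntry
  fun_prop

theorem output : PolyTime (fun a : Ctx × ℕ => output t a.1 a.2) := by
  unfold RAM.output
  fun_prop

end PolyTime

end RAM

/-! ## Maximin shares on a cycle -/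

namespace FairDivision

theorem sum_arc {M : Type} [AddCommMonoid M] {m s j j' : ℕ} (hs : s < m) (hj' : j' ≤ m)
    (F : ℕ → M) : ∑ i ∈ Finset.range (j' - j), F (wrap m (s + (j + i))) =
      ∑ g ∈ arc m s j j', F g := by
  refine Finset.sum_bij' (fun i _ => goodAt hs (j + i)) (fun g _ => cyclePos m s g - j) ?_ ?_ ?_
    ?_ ?_
  · intro i hi
    rw [Finset.mem_range] at hi
    rw [mem_arc, cyclePos_goodAt hs (by omega)]
    omega
  · intro g hg
    rw [mem_arc] at hg
    rw [Finset.mem_range]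
    omega
  · intro i hi
    rw [Finset.mem_range] at hi
    rw [cyclePos_goodAt hs (by omega)]
    omega
  · intro g hg
    rw [mem_arc] at hg
    rw [Nat.add_sub_cancel' hg.1, goodAt_cyclePos]
  · intro i hi
    rw [Finset.mem_range] at hi
    rw [val_goodAt hs (by omega)]

theorem exists_eq_arc {m : ℕ} (hm : 0 < m) {ι : Type} {P : ι → Finset (Fin m)}
    (hP : IsSplit (SimpleGraph.cycleGraph m) P) (i : ι) :
    ∃ s < m, ∃ j ≤ m, ∃ j' ≤ m, P i = arc m s j j' := by
  obtain ⟨s, hs, hconv⟩ := exists_cut hm hP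
  rcases (P i).eq_empty_or_nonempty with h | h
  · refine ⟨s, hs, 0, by omega, 0, by omega, ?_⟩
    rw [h, eq_comm, Finset.eq_empty_iff_forall_notMem]
    intro g hg
    rw [mem_arc] at hg
    omega
  · obtain ⟨a, ha, hmin⟩ := Finset.exists_min_image (P i) (fun g => cyclePos m s g) h
    obtain ⟨b, hb, hmax⟩ := Finset.exists_max_image (P i) (fun g => cyclePos m s g) h
    have hbm := cyclePos_lt hs b.2
    refine ⟨s, hs, cyclePos m s a, (cyclePos_lt hs a.2).le, cyclePos m s b + 1, hbm, ?_⟩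
    ext g
    rw [mem_arc]
    constructor
    · intro hg
      exact ⟨hmin g hg, Nat.lt_succ_of_le (hmax g hg)⟩
    · rintro ⟨h1, h2⟩
      rw [← goodAt_cyclePos hs g]
      refine hconv i _ _ _ h1 (Nat.le_of_lt_succ h2) hbm ?_ ?_ <;> rwa [goodAt_cyclePos]

/-- The worst bundle of an optimal split attains the share and is an arc by `exists_eq_arc`. So the
share is one of polynomially many arc values, namely the greatest one that some split guarantees in
all its bundles. -/
theorem maximinShare_le_iff {m n : ℕ} (hm : 0 < m) (hn : 0 < n) {u : Fin m → ℝ}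
    (hu : ∀ g, 0 ≤ u g) (v : ℝ) : maximinShare (SimpleGraph.cycleGraph m) u n ≤ v ↔
      ∀ s < m, ∀ j ≤ m, ∀ j' ≤ m, (∃ P : Fin n → Finset (Fin m),
        IsSplit (SimpleGraph.cycleGraph m) P ∧ ∀ i, value u (arc m s j j') ≤ value u (P i)) →
        value u (arc m s j j') ≤ v := by
  have hmax := isGreatest_maximinShare (SimpleGraph.cycleGraph m)
    SimpleGraph.cycleGraph_preconnected u hu n hn
  constructor
  · rintro h s - j - j' - hP
    exact (hmax.2 ⟨Finset.sum_nonneg fun g _ => hu g, hP⟩).trans h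
  · intro h
    obtain ⟨-, P, hP, hle⟩ := hmax.1
    have : Nonempty (Fin n) := ⟨⟨0, hn⟩⟩
    obtain ⟨i, hi⟩ := Finite.exists_min fun i => value u (P i)
    obtain ⟨s, hs, j, hj, j', hj', hPi⟩ := exists_eq_arc hm hP i
    have := h s hs j hj j' hj' ⟨P, hP, fun k => hPi ▸ hi k⟩
    exact (hle i).trans (hPi ▸ this)

theorem isSplit_bundlesOf {V ι : Type} [Fintype V] [DecidableEq ι] {G : SimpleGraph V} {f : V → ι}
    (h : ∀ a, IsBundle G (bundlesOf f a)) : IsSplit G (bundlesOf f) := by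
  refine ⟨h, fun i j hij => ?_, fun v => ⟨f v, by simp [bundlesOf]⟩⟩
  rw [Finset.disjoint_left]
  intro v hi hj
  simp only [bundlesOf, Finset.mem_filter, Finset.mem_univ, true_and] at hi hj
  exact hij (hi.symm.trans hj)

/-- If there are more agents than goods, then every maximin share is `0`. -/
theorem maximinShare_eq_zero_of_lt {m n : ℕ} (h : m < n) (G : SimpleGraph (Fin m))
    (u : Fin m → ℝ) : maximinShare G u n ≤ 0 := by
  refine Real.sSup_le ?_ le_rfl
  rintro q ⟨-, P, ⟨-, hD, -⟩, hq⟩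
  by_contra hpos
  have hne (i : Fin n) : (P i).Nonempty := by
    by_contra hemp
    have := hq i
    rw [Finset.not_nonempty_iff_eq_empty.1 hemp, value, Finset.sum_empty] at this
    exact hpos this
  choose g hg using hne
  have hinj : Function.Injective g := by
    intro i j hij
    by_contra hne
    exact Finset.disjoint_left.1 (hD i j hne) (hg i) (hij ▸ hg j)
  have := Fintype.card_le_of_injective g hinj
  simp at this
  omega

end FairDivision

/-! ## Correctness of the algorithm -/

namespace RAM

open FairDivision

/-- The context `x` represents the instance `I`. -/
structure Represents {t : ℕ} (I : CycleInstance t) (x : Ctx) : Prop where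
  inp_m : x.inp 0 = I.m
  inp_num : ∀ (r : Fin t) (k : Fin I.m), x.inp (1 + r * (I.m + I.m) + (k + k) + 0) = I.num r k
  inp_den : ∀ (r : Fin t) (k : Fin I.m), x.inp (1 + r * (I.m + I.m) + (k + k) + 1) = I.den r k
  inp_count : ∀ r : Fin t, x.inp (1 + t * (I.m + I.m) + r) = I.count r
  inp_lt : ∀ i, x.inp i < 2 ^ x.B
  m_lt : I.m + 1 < x.B
  t_le : t ≤ x.B

theorem sum_digits_lt {T n : ℕ} {cnt : Fin T → ℕ} (h : ∀ q, cnt q ≤ n) :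
    ∑ q, cnt q * (n + 1) ^ (q : ℕ) < (n + 1) ^ T := by
  induction T with
  | zero => simp
  | succ T ih =>
    rw [Fin.sum_univ_castSucc, pow_succ]
    have h1 := ih (cnt := fun q => cnt q.castSucc) (fun q => h _)
    have h2 := Nat.mul_le_mul_right ((n + 1) ^ T) (h (Fin.last T))
    simp only [Fin.val_castSucc, Fin.val_last]
    rw [Nat.mul_succ, mul_comm ((n + 1) ^ T)]
    omega

namespace Represents

variable {t : ℕ} {I : CycleInstance t} {x : Ctx}

theorem den_prod_pos (I : CycleInstance t) (r : Fin t) : (0 : ℝ) < ∏ k, (I.den r k : ℝ) :=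
  Finset.prod_pos fun k _ => by exact_mod_cast I.den_pos r k

theorem le_pow {k : ℕ} (hk : k ≤ x.B) : k ≤ x.B ^ (t + 1) :=
  hk.trans (Nat.le_self_pow (by omega) _)

theorem mul_of_le {a : ℕ} (b : ℕ) (ha : a ≤ x.B) : mul (t + 1) x a b = a * b :=
  mul_eq _ _ _ (lt_two_pow_of_le (le_pow ha))

variable (h : Represents I x)
include h

/-- Input integers may be exponential in `x.B`, but as first factors they need only few bits; this
covers the products of denominators. -/
theorem mul_inp (i b : ℕ) : mul (t + 1) x (x.inp i) b = x.inp i * b :=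
  mul_eq _ _ _ ((h.inp_lt i).trans_le (Nat.pow_le_pow_right (by omega) (le_pow le_rfl)))

theorem weight_eq (r : Fin t) (j : Fin I.m) :
    weight t x r j = ∏ k : Fin I.m, if k = j then I.num r k else I.den r k := by
  have hm := h.m_lt
  have key := boundedRec_induction (t + 1) x (n := x.inp 0) (a := 1)
    (f := fun k v => mul (t + 1) x (x.inp (1 + mul (t + 1) x r (x.inp 0 + x.inp 0) + (k + k) +
      if k = (j : ℕ) then 0 else 1)) v)
    (fun n v => v = ∏ k ∈ Finset.range n, x.inp (1 + r * (I.m + I.m) + (k + k) +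
      if k = (j : ℕ) then 0 else 1)) (by rw [h.inp_m]; exact le_pow (by omega)) rfl (by
        rintro i v - rfl
        rw [mul_of_le _ (r.2.le.trans h.t_le), h.mul_inp, h.inp_m, Finset.prod_range_succ,
          mul_comm])
  rw [weight, key, h.inp_m, Finset.prod_range]
  refine Finset.prod_congr rfl fun k _ => ?_
  by_cases hkj : k = j
  · rw [if_pos (by rw [hkj]), if_pos hkj, h.inp_num]
  · rw [if_neg (fun h => hkj (Fin.ext h)), if_neg hkj, h.inp_den]

theorem count_eq (r : Fin t) : count t x r = I.count r := by
  rw [count, mul_of_le _ h.t_le, h.inp_m, h.inp_count]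

theorem agents_eq : agents t x = ∑ r, I.count r := by
  rw [agents, sum_eq _ _ _ (le_pow h.t_le), Finset.sum_range]
  exact Finset.sum_congr rfl fun r _ => h.count_eq r

theorem count_le (r : Fin t) : I.count r ≤ agents t x := by
  rw [h.agents_eq]
  exact Finset.single_le_sum (f := I.count) (fun _ _ => Nat.zero_le _) (Finset.mem_univ r)

theorem card_agent : Fintype.card I.Agent = agents t x := by
  rw [h.agents_eq]
  simp [CycleInstance.Agent]

theorem agents_pos : 0 < agents t x := by
  rw [h.agents_eq]
  exact I.agents_pos

theorem weight_eq_mul (r : Fin t) (j : Fin I.m) :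
    (weight t x r j : ℝ) = (∏ k, (I.den r k : ℝ)) * (I.num r j / I.den r j) := by
  have hd : (I.den r j : ℝ) ≠ 0 := by exact_mod_cast (I.den_pos r j).ne'
  rw [h.weight_eq, Nat.cast_prod, ← Finset.mul_prod_erase _ _ (Finset.mem_univ j),
    ← Finset.mul_prod_erase _ (fun k => (I.den r k : ℝ)) (Finset.mem_univ j), if_pos rfl,
    Finset.prod_congr (g := fun k => (I.den r k : ℝ)) rfl fun k hk => by
      rw [if_neg (Finset.ne_of_mem_erase hk)]]
  field_simp

theorem arcValue_eq (r : Fin t) {s j j' : ℕ} (hs : s < I.m) (hj' : j' ≤ I.m) :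
    (arcValue t x r s j j' : ℝ) = (∏ k, (I.den r k : ℝ)) *
      value (fun g => (I.num r g : ℝ) / I.den r g) (arc I.m s j j') := by
  have hm := h.m_lt
  rw [arcValue, sum_eq _ _ _ (le_pow (by omega)), h.inp_m,
    sum_arc hs hj' (fun g => weight t x r g), Nat.cast_sum, value, Finset.mul_sum]
  exact Finset.sum_congr rfl fun g _ => h.weight_eq_mul r g

theorem arcValue_le_iff (r : Fin t) {s j j' s' i i' : ℕ} (hs : s < I.m) (hj' : j' ≤ I.m)
    (hs' : s' < I.m) (hi' : i' ≤ I.m) : arcValue t x r s j j' ≤ arcValue t x r s' i i' ↔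
      value (fun g => (I.num r g : ℝ) / I.den r g) (arc I.m s j j') ≤
        value (fun g => (I.num r g : ℝ) / I.den r g) (arc I.m s' i i') := by
  rw [← Nat.cast_le (α := ℝ), h.arcValue_eq r hs hj', h.arcValue_eq r hs' hi',
    mul_le_mul_iff_right₀ (den_prod_pos I r)]

variable (hn : agents t x ≤ I.m)
include hn

theorem stride_eq {r : ℕ} (hr : r ≤ t) : stride t x r = (agents t x + 1) ^ r := by
  have hm := h.m_lt
  refine boundedRec_induction _ _ (fun k v => v = (agents t x + 1) ^ k)
    (le_pow (hr.trans h.t_le)) rfl ?_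
  rintro i v - rfl
  rw [mul_of_le _ (by omega), pow_succ, mul_comm]

theorem budget_eq : budget t x = ∑ r : Fin t, I.count r * (agents t x + 1) ^ (r : ℕ) := by
  have hm := h.m_lt
  rw [budget, sum_eq _ _ _ (le_pow h.t_le), Finset.sum_range]
  refine Finset.sum_congr rfl fun r _ => ?_
  have := h.count_le r
  rw [h.count_eq, mul_of_le _ (by omega), h.stride_eq hn r.2.le]

/-- The reason for the exponent `t + 1` in all loops: there are at most `(n + 1) ^ t` budgets and `m
+ 1` positions, and `n ≤ m` makes each factor at most `x.B`. -/
theorem table_size_le {T : ℕ} (hT : T ≤ t) {cnt : Fin T → ℕ} (hc : ∀ q, cnt q ≤ agents t x) :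
    (∑ q, cnt q * (agents t x + 1) ^ (q : ℕ) + 1) * (I.m + 1) ≤ x.B ^ (t + 1) := by
  have hm := h.m_lt
  rw [pow_succ]
  refine Nat.mul_le_mul ?_ (by omega)
  calc _ ≤ (agents t x + 1) ^ T := sum_digits_lt hc
    _ ≤ x.B ^ T := Nat.pow_le_pow_left (by omega) T
    _ ≤ x.B ^ t := Nat.pow_le_pow_right (by omega) hT

variable {T : ℕ} (hT : T ≤ t) {cnt : Fin T → ℕ} (hc : agents t x = ∑ q, cnt q)
  {N : ℕ} (hN : N = ∑ q, cnt q * (agents t x + 1) ^ (q : ℕ))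
include hT hc hN

theorem table_size_le' : (N + 1) * (I.m + 1) ≤ x.B ^ (t + 1) := by
  rw [hN]
  refine h.table_size_le hn hT fun q => ?_
  rw [hc]
  exact Finset.single_le_sum (f := cnt) (fun _ _ => Nat.zero_le _) (Finset.mem_univ q)

/-- With `T` and `cnt` left open, this serves both the test of levels, with one type of `n` agents,
and the search for an allocation, with all `t` types. -/
theorem bit_completions_iff {ok : ℕ → ℕ → ℕ → ℕ} : bit (t + 1) x (completions (t + 1) x (x.inp 0) T N (stride t x) ok
    (agents t x)) (mul (t + 1) x N (x.inp 0 + 1)) ≠ 0 ↔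
    Completable I.m T (stride t x) (fun r j j' => ok r j j' ≠ 0) (agents t x) 0 N := by
  have hm := h.m_lt
  have hW := h.table_size_le' hn hT hc hN
  rw [h.inp_m, mul_budget hW _ (by omega), ← bit_completions hW (le_pow (hT.trans h.t_le))
    (le_pow (by omega)) (Nat.zero_le _) le_rfl, add_zero]

theorem exists_allocation {s : ℕ} (hs : s < I.m) {ok : ℕ → ℕ → ℕ → ℕ}
    (hC : Completable I.m T (stride t x) (fun r j j' => ok r j j' ≠ 0)
    (agents t x) 0 N) :
    ∃ f : Fin I.m → Σ q : Fin T, Fin (cnt q),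
      (∀ g : Fin I.m, ∀ i, i = (∑ k ∈ Finset.range (agents t x),
          if pathPos (t + 1) x (x.inp 0) T N (stride t x) ok (agents t x) (k + 1) ≤
            cyclePos I.m s g then 1 else 0) → i ≤ agents t x ∧
        ((f g).1 : ℕ) = pathType (t + 1) x (x.inp 0) T N (stride t x) ok (agents t x) i ∧
        ((f g).2 : ℕ) = ∑ k ∈ Finset.range i,
          if pathType (t + 1) x (x.inp 0) T N (stride t x) ok (agents t x) k =
            pathType (t + 1) x (x.inp 0) T N (stride t x) ok (agents t x) i then 1 else 0) ∧
      ∀ a, ∃ j j', j' ≤ I.m ∧ ok a.1 j j' ≠ 0 ∧ bundlesOf f a = arc I.m s j j' := by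
  have hm := h.m_lt
  have hW := h.table_size_le' hn hT hc hN
  -- As there is an agent, there is a type; so the exponent `t + 1` is at least `2`, enough for the
  -- pairs of a type and a position.
  have ht : 0 < t := by
    have := h.agents_pos
    rw [h.agents_eq] at this
    obtain ⟨r, -, -⟩ := Finset.exists_ne_zero_of_sum_ne_zero this.ne'
    exact r.pos
  have hTm : T * (I.m + 1) ≤ x.B ^ (t + 1) :=
    (Nat.mul_le_mul (hT.trans h.t_le) (show I.m + 1 ≤ x.B by omega)).trans (by
      rw [← pow_two]
      exact Nat.pow_le_pow_right (by omega) (by omega))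
  obtain ⟨h1, h2, h3, h4⟩ := path_spec hW hTm
    (le_pow (show agents t x ≤ x.B by omega)) hC
  rw [h.inp_m]
  have hle : ∀ i ≤ agents t x, pathPos (t + 1) x I.m T N (stride t x) ok (agents t x) i ≤ I.m := by
    intro i hi
    have key (k : ℕ) (hk : i + k ≤ agents t x) :
        pathPos (t + 1) x I.m T N (stride t x) ok (agents t x) i ≤
          pathPos (t + 1) x I.m T N (stride t x) ok (agents t x) (i + k) := by
      induction k with
      | zero => exact le_rfl
      | succ k ih => exact (ih (by omega)).trans (h3 (i + k) (by omega)).2.1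
    have := key (agents t x - i) (by omega)
    rwa [Nat.add_sub_cancel' hi, h2] at this
  have hsum : ∑ i ∈ Finset.range (agents t x), (agents t x + 1) ^
      pathType (t + 1) x I.m T N (stride t x) ok (agents t x) i =
        ∑ q, cnt q * (agents t x + 1) ^ (q : ℕ) := by
    rw [← hN, ← Finset.sum_congr rfl fun i hi =>
      h.stride_eq hn ((h3 i (Finset.mem_range.1 hi)).1.le.trans hT), h4]
  obtain ⟨f, hf1, hf2⟩ := FairDivision.exists_allocation hs (cnt := cnt) hc (Nat.lt_succ_self _) h1 h2
    (fun i hi => (h3 i hi).2.1) (fun i hi => (h3 i hi).1) hsum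
  refine ⟨f, fun g i hi => ⟨?_, hf1 g i hi⟩, fun a => ?_⟩
  · rw [hi, ← Finset.sum_filter, Finset.sum_const, smul_eq_mul, mul_one]
    exact (Finset.card_filter_le _ _).trans (by simp)
  · obtain ⟨i, hi, hia, hfa⟩ := hf2 a
    exact ⟨_, _, hle _ hi, hia ▸ (h3 i hi).2.2, hfa⟩

end Represents

end RAM

namespace RAM

open FairDivision

/-! ### The tests and the output mean what they should -/

namespace Represents

variable {t : ℕ} {I : CycleInstance t} {x : Ctx} (h : Represents I x)
include h

theorem sum_ne_zero_iff {n : ℕ} (f : ℕ → ℕ) (hn : n ≤ I.m + 1) :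
    sum (t + 1) x n f ≠ 0 ↔ ∃ i < n, f i ≠ 0 := by
  have hm := h.m_lt
  rw [sum_eq _ _ _ (le_pow (show n ≤ x.B by omega)), Ne, Finset.sum_eq_zero_iff]
  simp

variable (hn : agents t x ≤ I.m)
include hn

theorem m_pos : 0 < I.m := lt_of_lt_of_le h.agents_pos hn

/-- With a single type of stride `1` the budget merely counts bundles. A completable start gives a
split into arcs, and conversely a split is cut open by `completable_of_split`. -/
theorem isLevel_iff (r : Fin t) (q : ℕ) : isLevel t x r q ≠ 0 ↔
    ∃ P : Fin (agents t x) → Finset (Fin I.m), IsSplit (SimpleGraph.cycleGraph I.m) P ∧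
      ∀ i, (q : ℝ) ≤ (∏ k, (I.den r k : ℝ)) *
        value (fun g => (I.num r g : ℝ) / I.den r g) (P i) := by
  have hT : 1 ≤ t := Nat.one_le_of_lt r.2
  have hc : agents t x = ∑ _q : Fin 1, agents t x := by simp
  have hN : agents t x = ∑ q : Fin 1, agents t x * (agents t x + 1) ^ (q : ℕ) := by simp
  have hok (s j j' : ℕ) : atLeast t x r q s j j' ≠ 0 ↔ q ≤ arcValue t x r s j j' := by
    simp [atLeast]
  rw [isLevel, h.sum_ne_zero_iff _ (by rw [h.inp_m]; omega)]
  simp only [h.bit_completions_iff hn hT hc hN]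
  rw [h.inp_m]
  constructor
  · rintro ⟨s, hs, hC⟩
    obtain ⟨f, -, hf⟩ := h.exists_allocation hn hT hc hN hs hC
    have hsplit := isSplit_bundlesOf (G := SimpleGraph.cycleGraph I.m) (f := f) fun a => by
      obtain ⟨j, j', hj', -, hfa⟩ := hf a
      rw [hfa]
      exact isBundle_arc hs hj'
    refine ⟨fun i => bundlesOf f ⟨0, i⟩, ⟨fun i => hsplit.1 _, fun i j hij => hsplit.2.1 _ _ ?_,
      fun v => ?_⟩, fun i => ?_⟩
    · intro he
      exact hij (eq_of_heq (Sigma.mk.inj he).2)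
    · obtain ⟨⟨a, i⟩, hv⟩ := hsplit.2.2 v
      obtain rfl : a = 0 := Subsingleton.elim _ _
      exact ⟨i, hv⟩
    · obtain ⟨j, j', hj', hq, hfa⟩ := hf ⟨0, i⟩
      dsimp only
      rw [hfa, ← h.arcValue_eq r hs hj', Nat.cast_le]
      exact (hok s j j').1 hq
  · rintro ⟨P, hP, hq⟩
    obtain ⟨s, hs, hcomp⟩ := completable_of_split (h.m_pos hn) hP
    refine ⟨s, hs, ?_⟩
    have := hcomp 1 (stride t x) (fun _ j j' => atLeast t x r q s j j' ≠ 0) (fun _ => 0)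
      (fun _ => Nat.one_pos) (fun i j j' _ hj' hPi => by
        have := hq i
        rwa [hPi, ← h.arcValue_eq r hs hj', Nat.cast_le, ← hok] at this)
    simpa [h.stride_eq hn (Nat.zero_le t)] using this

/-- Both sides say that no arc of greater value is a level. The common positive factor of the scaled
values cancels in every comparison. -/
theorem isFair_iff (r : Fin t) {s j j' : ℕ} (hs : s < I.m) (hj' : j' ≤ I.m) :
    isFair t x s r j j' ≠ 0 ↔
      maximinShare (SimpleGraph.cycleGraph I.m) (fun g => (I.num r g : ℝ) / I.den r g)
        (agents t x) ≤ value (fun g => (I.num r g : ℝ) / I.den r g) (arc I.m s j j') := by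
  have hD := den_prod_pos I r
  have hdef : isFair t x s r j j' ≠ 0 ↔ ¬ deficiency t x r (arcValue t x r s j j') ≠ 0 := by
    simp [isFair]
  rw [hdef, deficiency, h.sum_ne_zero_iff _ (by rw [h.inp_m]; omega), h.inp_m]
  simp only [h.sum_ne_zero_iff _ le_rfl]
  rw [maximinShare_le_iff (h.m_pos hn) h.agents_pos
    (fun g => div_nonneg (Nat.cast_nonneg _) (Nat.cast_nonneg _))]
  push Not
  refine forall₂_congr fun s' hs' => ?_
  simp only [Nat.lt_succ_iff]
  refine forall₂_congr fun a _ => forall₂_congr fun b hb => ?_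
  rw [← h.arcValue_le_iff r hs' hb hs hj']
  have hlev : (∃ P : Fin (agents t x) → Finset (Fin I.m),
      IsSplit (SimpleGraph.cycleGraph I.m) P ∧
        ∀ i, value (fun g => (I.num r g : ℝ) / I.den r g) (arc I.m s' a b) ≤
          value (fun g => (I.num r g : ℝ) / I.den r g) (P i)) ↔
      isLevel t x r (arcValue t x r s' a b) ≠ 0 := by
    rw [h.isLevel_iff hn, h.arcValue_eq r hs' hb]
    simp only [mul_le_mul_iff_right₀ hD]
  rw [hlev]
  split_ifs <;> simp_all

theorem isCut_iff {s : ℕ} : isCut t x s ≠ 0 ↔ Completable I.m t (stride t x)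
    (fun r j j' => isFair t x s r j j' ≠ 0) (agents t x) 0 (budget t x) :=
  h.bit_completions_iff hn le_rfl h.agents_eq (h.budget_eq hn)

/-- Completeness: any mms-allocation, whatever its bundles, leaves a trace in the dynamic program
for the cut that suits it. -/
theorem exists_isCut {P : I.Agent → Finset (Fin I.m)} (hP : I.IsMMSAllocation P) :
    ∃ s < I.m, isCut t x s ≠ 0 := by
  obtain ⟨hsplit, hfair⟩ := hP
  rw [h.card_agent] at hfair
  obtain ⟨s, hs, hcomp⟩ := completable_of_split (h.m_pos hn) hsplit
  refine ⟨s, hs, (h.isCut_iff hn).2 ?_⟩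
  have := hcomp t (stride t x) (fun r j j' => isFair t x s r j j' ≠ 0) (fun a => a.1)
    (fun a => a.1.2) (fun a j j' _ hj' hPa => by
      rw [h.isFair_iff hn a.1 hs hj', ← hPa]
      exact hfair a)
  rw [h.card_agent] at this
  convert this using 1
  rw [h.budget_eq hn, Fintype.sum_sigma]
  refine Finset.sum_congr rfl fun r _ => ?_
  simp [h.stride_eq hn r.2.le]

theorem exists_output (hcut : ∃ s < I.m, isCut t x s ≠ 0) : ∃ f : Fin I.m → I.Agent,
    I.IsMMSAllocation (bundlesOf f) ∧ ∀ g : Fin I.m,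
      bundleType t x (bundleIndex t x g) = (f g).1 ∧
      bundleRank t x (bundleIndex t x g) = (f g).2 := by
  have hm := h.m_lt
  obtain ⟨hs, hcut⟩ := find_spec (t + 1) x (n := x.inp 0) (f := isCut t x)
    (by rw [h.inp_m]; exact le_pow (by omega)) (by rwa [h.inp_m])
  rw [← cut.eq_1] at hs hcut
  rw [h.inp_m] at hs
  obtain ⟨f, hf1, hf2⟩ := h.exists_allocation hn le_rfl h.agents_eq (h.budget_eq hn) hs
    ((h.isCut_iff hn).1 hcut)
  refine ⟨f, ⟨isSplit_bundlesOf fun a => ?_, fun a => ?_⟩, fun g => ?_⟩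
  · obtain ⟨j, j', hj', -, hfa⟩ := hf2 a
    rw [hfa]
    exact isBundle_arc hs hj'
  · obtain ⟨j, j', hj', hfair, hfa⟩ := hf2 a
    rw [h.card_agent, hfa]
    exact (h.isFair_iff hn a.1 hs hj').1 hfair
  · have hidx := sum_eq (t + 1) x (n := agents t x) (fun k => if bundlePos t x (k + 1) ≤
      cyclePos (x.inp 0) (cut t x) g then 1 else 0) (le_pow (by omega))
    rw [← bundleIndex.eq_1 t x g, h.inp_m] at hidx
    obtain ⟨hle, h1, h2⟩ := hf1 g _ hidx
    refine ⟨h1.symm, ?_⟩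
    rw [bundleRank, sum_eq _ _ _ (le_pow (show bundleIndex t x g ≤ x.B by omega)), h2]
    rfl

end Represents

/-- If there are more agents than goods, then one agent may receive everything. -/
theorem isMMSAllocation_const {t : ℕ} {I : CycleInstance t} (h : I.m < Fintype.card I.Agent)
    (a : I.Agent) : I.IsMMSAllocation (bundlesOf fun _ => a) := by
  refine ⟨isSplit_bundlesOf fun b => ?_, fun b => ?_⟩
  · by_cases hab : a = b
    · simpa [bundlesOf, hab] using isBundle_univ _ SimpleGraph.cycleGraph_preconnected
    · simpa [bundlesOf, hab] using isBundle_empty _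
  · exact (maximinShare_eq_zero_of_lt h _ _).trans
      (Finset.sum_nonneg fun g _ => div_nonneg (Nat.cast_nonneg _) (Nat.cast_nonneg _))

theorem map_range_two_mul (m : ℕ) (F : ℕ → ℕ) : (List.range (m + m)).map F =
    (List.ofFn fun j : Fin m => [F (2 * j), F (2 * j + 1)]).flatten := by
  induction m with
  | zero => simp
  | succ m ih =>
    rw [List.ofFn_succ', List.concat_eq_append, List.flatten_append,
      show m + 1 + (m + 1) = m + m + 1 + 1 by omega, List.range_succ, List.range_succ]
    simp only [List.map_append, ih, Fin.val_castSucc, Fin.val_last, List.append_assoc, two_mul]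
    simp

theorem map_output_eq {t : ℕ} {I : CycleInstance t} {x : Ctx} {f : Fin I.m → I.Agent}
    (h0 : output t x 0 = 1) (h1 : ∀ g : Fin I.m, outputEntry t x (2 * g) = (f g).1)
    (h2 : ∀ g : Fin I.m, outputEntry t x (2 * g + 1) = (f g).2) :
    (List.range (1 + (I.m + I.m))).map (output t x) = I.encodeAllocation f := by
  rw [add_comm 1, List.range_succ_eq_map, List.map_cons, h0, List.map_map,
    CycleInstance.encodeAllocation]
  congr 1
  have : output t x ∘ Nat.succ = outputEntry t x := by
    funext i
    simp [output]
  rw [this, map_range_two_mul]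
  simp only [h1, h2]

/-- The output is correct. -/
theorem isCorrectOutput {t : ℕ} {I : CycleInstance t} {x : Ctx} (h : Represents I x) :
    I.IsCorrectOutput ((List.range (outputLength t x)).map fun i => output t x i) := by
  have half1 (g : ℕ) : 2 * g / 2 = g := by omega
  have half2 (g : ℕ) : (2 * g + 1) / 2 = g := by omega
  by_cases hn : agents t x ≤ I.m
  · have hsolv := h.sum_ne_zero_iff (isCut t x) (Nat.le_succ I.m)
    by_cases hcut : ∃ s < I.m, isCut t x s ≠ 0
    · obtain ⟨f, hf, hout⟩ := h.exists_output hn hcut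
      have hsolv := hsolv.2 hcut
      refine .inl ⟨⟨_, hf⟩, f, hf, ?_⟩
      rw [outputLength, isSolvable, h.inp_m, if_pos hn, if_neg hsolv]
      apply map_output_eq
      · rw [output, if_pos rfl, isSolvable, h.inp_m, if_pos hn, if_neg hsolv]
      · intro g
        rw [outputEntry, h.inp_m, if_pos hn, half1, if_pos (by omega), (hout g).1]
      · intro g
        rw [outputEntry, h.inp_m, if_pos hn, half2, if_neg (by omega), (hout g).2]
    · have hsolv := not_not.1 (mt hsolv.1 hcut)
      refine .inr ⟨fun ⟨P, hP⟩ => hcut (h.exists_isCut hn hP), ?_⟩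
      rw [outputLength, isSolvable, h.inp_m, if_pos hn, if_pos hsolv]
      simp [output, isSolvable, h.inp_m, hn, hsolv]
  -- With more agents than goods, the agent with index `0` of any type that occurs takes all goods;
  -- the dynamic program is not consulted.
  · have hpos : ∃ r < t, count t x r ≠ 0 := by
      have := h.agents_pos
      rw [agents, sum_eq _ _ _ (Represents.le_pow h.t_le)] at this
      obtain ⟨r, hr, hr0⟩ := Finset.exists_ne_zero_of_sum_ne_zero this.ne'
      exact ⟨r, Finset.mem_range.1 hr, hr0⟩
    obtain ⟨hr, hr0⟩ := find_spec (t + 1) x (Represents.le_pow h.t_le) hpos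
    generalize hr' : find (t + 1) x t (count t x) = r at hr hr0
    have hc := h.count_eq ⟨r, hr⟩
    dsimp only at hc
    have hf := isMMSAllocation_const (I := I) (by rw [h.card_agent]; omega)
      ⟨⟨r, hr⟩, ⟨0, by omega⟩⟩
    refine .inl ⟨⟨_, hf⟩, _, hf, ?_⟩
    rw [outputLength, h.inp_m, if_neg hn]
    apply map_output_eq
    · rw [output, if_pos rfl, h.inp_m, if_neg hn]
    · intro g
      rw [outputEntry, h.inp_m, if_neg hn, half1, if_pos (by omega), hr']
    · intro g
      rw [outputEntry, h.inp_m, if_neg hn, half2, if_neg (by omega)]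

/-! ## The input -/

theorem length_flatten_ofFn {n len : ℕ} (L : Fin n → List ℕ) (hL : ∀ r, (L r).length = len) :
    (List.ofFn L).flatten.length = n * len := by
  induction n with
  | zero => simp
  | succ n ih =>
    rw [List.ofFn_succ, List.flatten_cons, List.length_append, hL, ih _ fun r => hL _]
    ring

theorem getElem?_flatten_ofFn {n len : ℕ} (L : Fin n → List ℕ) (hL : ∀ r, (L r).length = len)
    (r : Fin n) {i : ℕ} (hi : i < len) : (List.ofFn L).flatten[r * len + i]? = (L r)[i]? := by
  induction n with
  | zero => exact r.elim0
  | succ n ih =>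
    rw [List.ofFn_succ, List.flatten_cons]
    refine Fin.cases ?_ (fun r => ?_) r
    · rw [List.getElem?_append_left (by simpa [hL] using hi)]
      simp
    · rw [List.getElem?_append_right (by simp [hL, Nat.add_mul]; omega),
        ← ih (fun r => L r.succ) (fun r => hL _) r]
      congr 1
      rw [hL, Fin.val_succ, Nat.add_mul]
      omega

theorem length_le_bitLength (xs : List ℕ) : xs.length ≤ bitLength xs := by
  induction xs with
  | nil => simp
  | cons a xs ih =>
    rw [bitLength_cons, List.length_cons]
    omega

theorem size_le_bitLength {xs : List ℕ} {a : ℕ} (ha : a ∈ xs) : Nat.size a ≤ bitLength xs := by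
  induction xs with
  | nil => simp at ha
  | cons b xs ih =>
    rw [bitLength_cons]
    rcases List.mem_cons.1 ha with rfl | ha
    · omega
    · have := ih ha
      omega

/-- Every integer contributes at least `1` to `size`, so one more unit per integer at most doubles
the total. -/
theorem bitLength_encode_le {t : ℕ} (I : CycleInstance t) : bitLength I.encode ≤ 2 * I.size := by
  rw [CycleInstance.size]
  induction I.encode with
  | nil => simp [bitLength]
  | cons a xs ih =>
    rw [bitLength_cons, List.map_cons, List.sum_cons]
    omega

theorem length_goods {t : ℕ} (I : CycleInstance t) (r : Fin t) :
    (List.ofFn fun j => [I.num r j, I.den r j]).flatten.length = I.m + I.m := by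
  rw [length_flatten_ofFn (len := 2) _ fun _ => rfl, mul_two]

theorem length_encode_tail {t : ℕ} (I : CycleInstance t) :
    ((List.ofFn fun r => (List.ofFn fun j => [I.num r j, I.den r j]).flatten).flatten
      ++ List.ofFn I.count).length = 2 * t * I.m + t := by
  rw [List.length_append, length_flatten_ofFn _ (length_goods I), List.length_ofFn]
  ring

/-- The bounds on `m` and `t` come from the mere number `2 * t * m + t + 1` of integers, each of
which adds at least `1` to the bit length; `1 ≤ t` is needed for `m`. -/
theorem represents_encode {t : ℕ} (ht : 1 ≤ t) (I : CycleInstance t) :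
    Represents I (Ctx.ofList I.encode) := by
  have hlen : I.encode.length = 2 * t * I.m + t + 1 := by
    rw [CycleInstance.encode, List.length_cons, length_encode_tail]
  have hle := length_le_bitLength I.encode
  have hmul : 1 * (2 * I.m) ≤ t * (2 * I.m) := Nat.mul_le_mul_right _ ht
  have hassoc : t * (2 * I.m) = 2 * t * I.m := by ring
  have hgoods (r : Fin t) (k : Fin I.m) (i : ℕ) (hi : i < 2) :
      I.encode[1 + r * (I.m + I.m) + (k + k) + i]? = [I.num r k, I.den r k][i]? := by
    have hk : (k : ℕ) * 2 + i < I.m + I.m := by omega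
    have hr : (r : ℕ) * (I.m + I.m) + (I.m + I.m) ≤ t * (I.m + I.m) := by
      rw [← Nat.succ_mul]
      exact Nat.mul_le_mul_right _ r.2
    rw [CycleInstance.encode,
      show 1 + r * (I.m + I.m) + (k + k) + i = r * (I.m + I.m) + (k * 2 + i) + 1 by omega,
      List.getElem?_cons_succ, List.getElem?_append_left (by
        rw [length_flatten_ofFn _ (length_goods I)]; omega),
      getElem?_flatten_ofFn _ (length_goods I) r hk,
      getElem?_flatten_ofFn (len := 2) _ (fun _ => rfl) k hi]
  refine ⟨rfl, fun r k => ?_, fun r k => ?_, fun r => ?_, fun i => ?_, ?_, ?_⟩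
  · have := hgoods r k 0 (by omega)
    rw [add_zero] at this
    simp [Ctx.ofList, List.getD_eq_getElem?_getD, this]
  · simp [Ctx.ofList, List.getD_eq_getElem?_getD, hgoods r k 1 (by omega)]
  · have : I.encode[1 + t * (I.m + I.m) + r]? = some (I.count r) := by
      rw [CycleInstance.encode, show 1 + t * (I.m + I.m) + r = t * (I.m + I.m) + r + 1 by omega,
        List.getElem?_cons_succ, List.getElem?_append_right (by
          rw [length_flatten_ofFn _ (length_goods I)]; omega),
        length_flatten_ofFn _ (length_goods I), Nat.add_sub_cancel_left]
      simp
    simp [Ctx.ofList, List.getD_eq_getElem?_getD, this]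
  · change I.encode.getD i 0 < 2 ^ bitLength I.encode
    rw [List.getD_eq_getElem?_getD]
    by_cases hi : i < I.encode.length
    · rw [List.getElem?_eq_getElem hi, Option.getD_some]
      exact (Nat.lt_size_self _).trans_le
        (Nat.pow_le_pow_right (by omega) (size_le_bitLength (List.getElem_mem hi)))
    · rw [List.getElem?_eq_none (by omega), Option.getD_none]
      positivity
  · change I.m + 1 < bitLength I.encode
    omega
  · change t ≤ bitLength I.encode
    omega

theorem polynomial_eval_mono (T : Polynomial ℕ) : Monotone fun a : ℕ => T.eval a := by
  intro a b hab
  dsimp only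
  rw [Polynomial.eval_eq_sum, Polynomial.eval_eq_sum]
  exact Finset.sum_le_sum fun i _ => Nat.mul_le_mul_left _ (Nat.pow_le_pow_left hab i)

end RAM

theorem mainTheorem12 (t : ℕ) (ht : 1 ≤ t) :
    ∃ (p : RAM.Program) (T : Polynomial ℕ), ∀ I : CycleInstance t,
      ∃ out : List ℕ, RAM.OutputsWithin p I.encode (T.eval I.size) out ∧
        I.IsCorrectOutput out := by
  obtain ⟨p, T, hp⟩ := RAM.exists_program (2 * t) t (RAM.PolyTime.outputLength (t := t))
    (RAM.PolyTime.output (t := t))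
  -- The time bound is in terms of `bitLength`, which is at most `2 * I.size`, and polynomials over
  -- `ℕ` are monotone.
  refine ⟨p, T.comp (2 * Polynomial.X), fun I => ?_⟩
  have h := RAM.represents_encode ht I
  refine ⟨_, ?_, RAM.isCorrectOutput h⟩
  have hlen : RAM.outputLength t (RAM.Ctx.ofList I.encode) ≤ RAM.bitLength I.encode := by
    have h1 := h.m_lt
    have h2 := RAM.length_le_bitLength I.encode
    have h3 : I.encode.length = 2 * t * I.m + t + 1 := by
      rw [CycleInstance.encode, List.length_cons, RAM.length_encode_tail]
    have h4 : 1 * (2 * I.m) ≤ t * (2 * I.m) := Nat.mul_le_mul_right _ ht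
    have h5 : t * (2 * I.m) = 2 * t * I.m := by ring
    rw [RAM.outputLength, h.inp_m]
    split_ifs <;> omega
  obtain ⟨k, hk, c, hc⟩ := hp I.m _ (RAM.length_encode_tail I) hlen
  refine ⟨k, hk.trans ?_, c, hc⟩
  rw [Polynomial.eval_comp]
  refine RAM.polynomial_eval_mono T ?_
  rw [Polynomial.eval_mul, Polynomial.eval_ofNat, Polynomial.eval_X]
  exact RAM.bitLength_encode_le I
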